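/- Let $G$ be a connected network on a finite vertex set $V$, i.e. a family of conductances $c_{xy}=c_{yx}\ge 0$ $(x,y\in V)$, where self-loops $c_{xx}>0$ are allowed and the graph with edges $\{xy: c_{xy}>0\}$ is connected. Write $c_x=\sum_y c_{xy}$ and assume $c_x>0$ for all $x$ (this excludes only a single vertex without self-loop). Fix $v_0,v\in V$ and let $N_v=\{u\neq v: c_{uv}>0\}$. Let $(X_s)_{s\ge 0}$ be the continuous-time random walk started at $v_0$, i.e. the right-continuous Markov jump process with rates $p_{xy}=c_{xy}/c_x$ for $x\ne y$. Define the local times $L^w_s=\frac1{c_w}\int_0^s \mathbf 1_{\{X_r=w\}}\,dr$ and the inverse local time $\tau(t)=\inf\{s: L^{v_0}_s>t\}$. Let $\tau_0=0$ and $\tau_{k+1}=\inf\{s>\tau_k: X_s\ne X_{\tau_k}\}$ be the jump times, $K=\max\{k:\tau_k\le\tau(t)\}$, and let $\mathcal P=(X_{\tau_0},\dots,X_{\tau_K})$ be the path of the embedded discrete walk up to time $\tau(t)$. For a path $P$ let $k_{u,v}(P)$ be the number of times that $P$ traverses the directed edge $\langle u,v\rangle$, and $k_v(P)=\sum_{u\in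 N_v}k_{u,v}(P)$ the number of visits to $v$. Let $\{\ell_w\}_{w\in V}$ be positive numbers such that $\ell_u\ell_v c_{uv}^2\le \frac1{16}$ for all $u\in N_v$. Put $t=\ell_{v_0}$ and $\Gamma=\{L^w_{\tau(t)}=\ell_w \text{ for all } w\in V\}$. Then the conditional law of $\mathcal P$ given $\Gamma$ is well defined, and $$\mathbb P\big(k_v(\mathcal P)\le 1118\,|N_v| \;\big|\; \Gamma\big)\;\ge\;\tfrac12 .$$ Here the conditional law given $\Gamma$ (in general an event of probability zero) is the probability measure $\nu$ on the set of finite paths such that, writing $L=(L^w_{\tau(t)})_{w\in V}$ and $\ell=(\ell_w)_{w\in V}$, every neighbourhood of $\ell$ has positive probability under the law of $L$, and for every set $A$ of paths $\mathbb P(\mathcal P\in A\mid L\in B)\to\nu(A)$ as the Borel sets $B\subset\mathbb R^V$ with $\mathbb P(L\in B)>0$ shrink to the point $\ell$ (that is, for every $\varepsilon>0$ there is a neighbourhood $U$ of $\ell$ such that $|\mathbb P(\mathcal P\in A\mid L\in B)-\nu(A)|<\varepsilon$ for all such $B\subset U$). -/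

import Mathlib

open MeasureTheory Filter Topology
open scoped NNReal ENNReal

/-- A network on the finite vertex set `V`: symmetric non-negative conductances. Self-loops
(`0 < c x x`) are allowed; `x y` is an edge exactly when `0 < c x y`. -/
structure Network (V : Type*) where
  c : V → V → ℝ
  nonneg : ∀ x y, 0 ≤ c x y
  symm : ∀ x y, c x y = c y x

/-- The network is connected: any two vertices are joined by a chain of edges. -/
def Network.Connected {V : Type*} (N : Network V) : Prop :=
  ∀ x y, Relation.ReflTransGen (fun a b => 0 < N.c a b) x y

/-- The total conductance `c_x = ∑_y c_{xy}`. -/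
noncomputable def Network.total {V : Type*} [Fintype V] (N : Network V) (x : V) : ℝ :=
  ∑ y, N.c x y

/-- The transition probability `p_{xy} = c_{xy} / c_x` of the discrete walk, which for `x ≠ y` is
also the jump rate from `x` to `y` of the continuous-time walk. -/
noncomputable def Network.rate {V : Type*} [Fintype V] (N : Network V) (x y : V) : ℝ :=
  N.c x y / N.total x

/-- The total rate at which the continuous-time walk leaves `x`. -/
noncomputable def Network.exitRate {V : Type*} [Fintype V] [DecidableEq V] (N : Network V)
    (x : V) : ℝ :=
  ∑ y ∈ Finset.univ.erase x, N.rate x y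

open Classical in
/-- The neighbours of `v` other than `v` itself. -/
noncomputable def Network.nbrs {V : Type*} [Fintype V] (N : Network V) (v : V) : Finset V :=
  Finset.univ.filter (fun u => u ≠ v ∧ 0 < N.c u v)

/-- The successive times at which the trajectory `x` changes its value:
`τ_0 = 0` and `τ_{k+1} = inf {r > τ_k : x r ≠ x τ_k}`, where `inf ∅ = ∞`. -/
noncomputable def jumpTime {V : Type*} (x : ℝ≥0 → V) : ℕ → ℝ≥0∞
  | 0 => 0
  | k + 1 => ⨅ (r : ℝ≥0) (_ : jumpTime x k < r ∧ x r ≠ x (jumpTime x k).toNNReal), (r : ℝ≥0∞)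

/-- `X` is (a version with right-continuous trajectories of) the continuous-time random walk on
the network started at `v₀`, i.e. the Markov jump process on `V` with jump rates `p_{xy}`, described
through the joint law of its jump chain and its holding times: from a vertex `a` the next vertex is
`b` with probability `p_{ab} / q_a`, where `q_a = ∑_{y ≠ a} p_{ay}`, and the holding times are,
given the jump chain, independent exponential variables with parameters `q_a`. -/
structure Network.IsWalk {V : Type*} [Fintype V] [DecidableEq V] (N : Network V) (v₀ : V)
    {Ω : Type*} [MeasurableSpace Ω] (μ : Measure Ω) (X : ℝ≥0 → Ω → V) : Prop where
  measurable : ∀ s w, MeasurableSet {ω | X s ω = w}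
  rightCont : ∀ᵐ ω ∂μ, ∀ s, ∀ᶠ r in 𝓝[>] s, X r ω = X s ω
  law : ∀ (n : ℕ) (y : ℕ → V) (r : ℕ → ℝ≥0), y 0 = v₀ → (∀ i < n, y i ≠ y (i + 1)) →
    μ {ω | (∀ i ≤ n, jumpTime (fun s => X s ω) i ≠ ⊤ ∧
              X (jumpTime (fun s => X s ω) i).toNNReal ω = y i) ∧
           ∀ i < n, jumpTime (fun s => X s ω) i + r i < jumpTime (fun s => X s ω) (i + 1)} =
      ENNReal.ofReal (∏ i ∈ Finset.range n,
        (N.rate (y i) (y (i + 1)) / N.exitRate (y i) *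
          Real.exp (-(N.exitRate (y i) * r i))))

/-- The local time `L_s^v = (1 / c_v) ∫_0^s 1_{x r = v} dr` of a trajectory `x`. -/
noncomputable def Network.localTime {V : Type*} [Fintype V] [DecidableEq V] (N : Network V)
    (x : ℝ≥0 → V) (v : V) (s : ℝ) : ℝ :=
  1 / N.total v * ∫ r in (0 : ℝ)..s, if x r.toNNReal = v then (1 : ℝ) else 0

/-- The inverse local time `τ(t) = inf {s : L_s^{v₀} > t}` at `v₀`, where `inf ∅ = ∞`. -/
noncomputable def Network.invLocalTime {V : Type*} [Fintype V] [DecidableEq V] (N : Network V)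
    (v₀ : V) (x : ℝ≥0 → V) (t : ℝ) : ℝ≥0∞ :=
  ⨅ (s : ℝ≥0) (_ : t < N.localTime x v₀ s), (s : ℝ≥0∞)

/-- The vector `(L_{τ(t)}^w)_w` of local times at the inverse local time. -/
noncomputable def Network.localTimesAt {V : Type*} [Fintype V] [DecidableEq V] (N : Network V)
    (v₀ : V) (t : ℝ) (x : ℝ≥0 → V) : V → ℝ :=
  fun w => N.localTime x w (N.invLocalTime v₀ x t).toReal

/-- `K = max {k : τ_k ≤ τ(t)}`, the number of jumps up to the inverse local time. -/
noncomputable def Network.numJumps {V : Type*} [Fintype V] [DecidableEq V] (N : Network V)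
    (v₀ : V) (t : ℝ) (x : ℝ≥0 → V) : ℕ :=
  sSup {k : ℕ | jumpTime x k ≤ N.invLocalTime v₀ x t}

/-- The path `(S_0, …, S_K)`, `S_k = x τ_k`, of the embedded discrete walk up to time `τ(t)`. -/
noncomputable def Network.embeddedPath {V : Type*} [Fintype V] [DecidableEq V] (N : Network V)
    (v₀ : V) (t : ℝ) (x : ℝ≥0 → V) : List V :=
  (List.range (N.numJumps v₀ t x + 1)).map (fun k => x (jumpTime x k).toNNReal)

/-- `k_{u,v}(P)`: how often the path `P` traverses the directed edge from `u` to `v`. -/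
def traversals {V : Type*} [DecidableEq V] (P : List V) (u v : V) : ℕ :=
  (P.zip P.tail).count (u, v)

/-- `k_v(P) = ∑_{u ∼ v} k_{u,v}(P)`: how often the path `P` visits `v`. -/
noncomputable def Network.visits {V : Type*} [Fintype V] [DecidableEq V] (N : Network V)
    (P : List V) (v : V) : ℕ :=
  ∑ u ∈ N.nbrs v, traversals P u v

/-- `ν` is the conditional law of the discrete variable `Z` given `L = ℓ` (in general an event of
probability zero): `ℓ` is in the support of the law of `L`, and for each set `A` of values of `Z`
the elementary conditional probability `μ(Z ∈ A, L ∈ B) / μ(L ∈ B)` tends to `ν(A)` as the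
measurable sets `B` with `μ(L ∈ B) > 0` shrink to the point `ℓ` (that is, they are eventually
contained in any given neighbourhood of `ℓ`; no other condition is put on their shape). Such a `ν`
is unique. When `(Z, L)` has a joint density that is continuous in the second variable, it is the
density at `ℓ` on `Z ∈ A` divided by the total density at `ℓ`. -/
structure IsConditionalLaw {Ω S ι : Type*} [Fintype ι] [MeasurableSpace Ω] (μ : Measure Ω)
    (Z : Ω → S) (L : Ω → ι → ℝ) (ℓ : ι → ℝ) (ν : PMF S) : Prop where
  mem_support : ∀ B ∈ 𝓝 ℓ, 0 < μ {ω | L ω ∈ B}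
  tendsto : ∀ A : Set S,
    Tendsto (fun B : Set (ι → ℝ) => μ {ω | Z ω ∈ A ∧ L ω ∈ B} / μ {ω | L ω ∈ B})
      ((𝓝 ℓ).smallSets ⊓ 𝓟 {B | MeasurableSet B ∧ 0 < μ {ω | L ω ∈ B}})
      (𝓝 (ν.toOuterMeasure A))

/-! The proof has an analytic half, which identifies the conditional law, and a combinatorial half,
which estimates it. Analytic half. Measured in local time, a stay at `w` is exponential with
parameter `escape w`, the total conductance from `w` to the other vertices. The parameter cancels
the denominator of the jump probability, so a path has joint density with the local times equal to
the product of its conductances times, for each `w`, the density of a sum of independent exponential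
stays. If `w` occurs `n` times, this gives `l ^ (n - 1) / (n - 1)!` times `exp (-escape w * l)`. At
`v₀` the last stay is interrupted by the stopping rule, and the survival probability supplies the
same expression at the fixed value `t`. The exponentials do not depend on the path, so the
conditional law is `pathWeight` normalised. The density formula is `measure_path_and_localTimes`;
`isConditionalLaw_of_density` passes from it to the limit over shrinking sets, with continuity of
the series by domination. Combinatorial half. Take a path `α u v β u v γ`, which traverses `⟨u, v⟩`
twice, and replace it by `α u β⁻¹ v γ`, where `β⁻¹` is `β` reversed. By symmetry of the conductances
this removes exactly the factor `c u v ^ 2`, and it removes one occurrence each of `u` and `v`. By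
the shape of the visit weights (`pathWeight_exchange`), the old weight is `ℓ u * ℓ v * c u v ^ 2`
times the new weight, divided by the product of the numbers of occurrences of `u` and `v` in the new
path. That product also bounds the number of ways in which a given path arises
(`tsum_decompositions_le`). Hence the excess `k - 1` of traversals, truncated at zero, has
conditional expectation at most `ℓ u * ℓ v * c u v ^ 2 ≤ 1 / 16`
(`tsum_pathWeight_mul_traversals_le`). Summing over the neighbours and applying Markov's inequality
bounds the number of visits (`tsum_pathWeight_le`). -/

/-- The product of the weights `c x y` over the steps of a list. -/
noncomputable def stepWeight {V : Type*} (c : V → V → ℝ≥0∞) : List V → ℝ≥0∞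
  | [] => 1
  | [_] => 1
  | x :: y :: q => c x y * stepWeight c (y :: q)

/-! ### Products of conductances along a path. -/

section StepWeight

variable {V : Type*} (c : V → V → ℝ≥0∞)

lemma stepWeight_append (α β : List V) (x : V) :
    stepWeight c (α ++ x :: β) = stepWeight c (α ++ [x]) * stepWeight c (x :: β) := by
  induction α with
  | nil => simp [stepWeight]
  | cons a α ih =>
    cases α with
    | nil => simp [stepWeight]
    | cons b α => simp only [List.cons_append, stepWeight] at ih ⊢; rw [ih, mul_assoc]

lemma stepWeight_reverse (hc : ∀ x y, c x y = c y x) (p : List V) :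
    stepWeight c p.reverse = stepWeight c p := by
  induction p with
  | nil => rfl
  | cons a p ih =>
    cases p with
    | nil => rfl
    | cons b p =>
      have h : (a :: b :: p).reverse = p.reverse ++ b :: [a] := by simp
      have h' : (b :: p).reverse = p.reverse ++ [b] := by simp
      rw [h, stepWeight_append, ← h', ih]
      simp [stepWeight, hc b a, mul_comm]

lemma stepWeight_append_two (α β : List V) (x y : V) :
    stepWeight c (α ++ x :: y :: β)
      = stepWeight c (α ++ [x]) * c x y * stepWeight c (y :: β) := by
  rw [stepWeight_append, stepWeight, mul_assoc]

/-- Exchanging a path that traverses `⟨u, v⟩` twice for the shortened path in which the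
part between the two traversals is reversed. -/
lemma stepWeight_exchange (hc : ∀ x y, c x y = c y x) (α β γ : List V) (u v : V) :
    stepWeight c (α ++ u :: v :: (β ++ u :: v :: γ))
      = c u v ^ 2 * stepWeight c (α ++ u :: (β.reverse ++ v :: γ)) := by
  have e1 : v :: (β ++ u :: v :: γ) = (v :: β) ++ u :: v :: γ := by simp
  have e2 : u :: (β.reverse ++ v :: γ) = (u :: β.reverse) ++ v :: γ := by simp
  have e3 : (u :: β.reverse) ++ [v] = (v :: β ++ [u]).reverse := by simp
  have e4 : stepWeight c (u :: β.reverse ++ v :: γ)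
      = stepWeight c (v :: β ++ [u]) * stepWeight c (v :: γ) := by
    rw [stepWeight_append, e3, stepWeight_reverse c hc]
  rw [stepWeight_append_two, e1, stepWeight_append_two,
    stepWeight_append c α (β.reverse ++ v :: γ) u, e2, e4]
  ring

end StepWeight

/-! ### Counting the decompositions of a path at traversals of an edge. -/

section Decompositions

variable {V : Type*} [DecidableEq V]

lemma traversals_cons_cons (x y u v : V) (q : List V) :
    traversals (x :: y :: q) u v = traversals (y :: q) u v + if x = u ∧ y = v then 1 else 0 := by
  simp [traversals, List.count_cons, Prod.ext_iff]

lemma exists_finset_traversals (u v : V) (p : List V) :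
    ∃ s : Finset (List V × List V), (∀ z ∈ s, p = z.1 ++ u :: v :: z.2) ∧
      s.card = traversals p u v := by
  induction p with
  | nil => exact ⟨∅, by simp, by simp [traversals]⟩
  | cons x q ih =>
    cases q with
    | nil => exact ⟨∅, by simp, by simp [traversals]⟩
    | cons y q =>
      obtain ⟨s, hs, hc⟩ := ih
      have hinj : Function.Injective (fun z : List V × List V => (x :: z.1, z.2)) := by
        rintro ⟨a, b⟩ ⟨a', b'⟩ h; simpa using h
      by_cases h : x = u ∧ y = v
      · refine ⟨insert ([], q) (s.image fun z => (x :: z.1, z.2)), ?_, ?_⟩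
        · intro z hz
          rcases Finset.mem_insert.1 hz with rfl | hz
          · simp [h.1, h.2]
          · obtain ⟨z, hz', rfl⟩ := Finset.mem_image.1 hz
            simpa using hs z hz'
        · rw [Finset.card_insert_of_notMem (by simp), Finset.card_image_of_injective _ hinj, hc,
            traversals_cons_cons, if_pos h]
      · refine ⟨s.image fun z => (x :: z.1, z.2), ?_, ?_⟩
        · intro z hz
          obtain ⟨z, hz', rfl⟩ := Finset.mem_image.1 hz
          simpa using hs z hz'
        · rw [Finset.card_image_of_injective _ hinj, hc, traversals_cons_cons, if_neg h, add_zero]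

/-- Pairing the first traversal with each later one already gives `k - 1` pairs. Since `u ≠ v`, two
traversals never overlap, so every later one lies in the remainder after the first. -/
lemma exists_finset_pairs_traversals {u v : V} (huv : u ≠ v) (p : List V) :
    ∃ s : Finset (List V × List V × List V),
      (∀ z ∈ s, p = z.1 ++ u :: v :: (z.2.1 ++ u :: v :: z.2.2)) ∧
      traversals p u v ≤ s.card + 1 := by
  induction p with
  | nil => exact ⟨∅, by simp, by simp [traversals]⟩
  | cons x q ih =>
    cases q with
    | nil => exact ⟨∅, by simp, by simp [traversals]⟩
    | cons y q =>
      by_cases h : x = u ∧ y = v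
      · obtain ⟨rfl, rfl⟩ := h
        obtain ⟨s, hs, hc⟩ := exists_finset_traversals x y q
        refine ⟨s.image fun z => ([], z), ?_, ?_⟩
        · intro z hz
          obtain ⟨z, hz', rfl⟩ := Finset.mem_image.1 hz
          simpa using hs z hz'
        · rw [Finset.card_image_of_injective _ (by rintro a b h; simpa using h), hc,
            traversals_cons_cons, if_pos ⟨rfl, rfl⟩]
          cases q with
          | nil => simp [traversals]
          | cons w q => rw [traversals_cons_cons, if_neg (fun h => huv h.1.symm), add_zero]
      · obtain ⟨s, hs, hc⟩ := ih
        have hinj : Function.Injective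
            (fun z : List V × List V × List V => (x :: z.1, z.2)) := by
          rintro ⟨a, b⟩ ⟨a', b'⟩ h; simpa using h
        refine ⟨s.image fun z => (x :: z.1, z.2), ?_, ?_⟩
        · intro z hz
          obtain ⟨z, hz', rfl⟩ := Finset.mem_image.1 hz
          simpa using hs z hz'
        · rw [Finset.card_image_of_injective _ hinj, traversals_cons_cons, if_neg h, add_zero]
          exact hc

lemma exists_finset_split (x : V) (p : List V) :
    ∃ s : Finset (List V × List V), (∀ z : List V × List V, p = z.1 ++ x :: z.2 → z ∈ s) ∧
      s.card ≤ p.count x := by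
  induction p with
  | nil => exact ⟨∅, by simp, by simp⟩
  | cons a q ih =>
    obtain ⟨s, hs, hc⟩ := ih
    by_cases h : a = x
    · refine ⟨insert ([], q) (s.image fun z => (a :: z.1, z.2)), ?_, ?_⟩
      · rintro ⟨α, δ⟩ hz
        cases α with
        | nil => simp_all
        | cons b α =>
          simp only [List.cons_append, List.cons.injEq] at hz
          refine Finset.mem_insert_of_mem (Finset.mem_image.2 ⟨(α, δ), hs _ hz.2, ?_⟩)
          simp [hz.1]
      · refine (Finset.card_insert_le _ _).trans ?_
        rw [h, List.count_cons_self]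
        exact Nat.add_le_add_right (Finset.card_image_le.trans hc) 1
    · refine ⟨s.image fun z => (a :: z.1, z.2), ?_, ?_⟩
      · rintro ⟨α, δ⟩ hz
        cases α with
        | nil => simp_all
        | cons b α =>
          simp only [List.cons_append, List.cons.injEq] at hz
          refine Finset.mem_image.2 ⟨(α, δ), hs _ hz.2, ?_⟩
          simp [hz.1]
      · rw [List.count_cons_of_ne h]
        exact Finset.card_image_le.trans hc

open Classical in
lemma traversals_sub_one_le_tsum {u v : V} (huv : u ≠ v) (p : List V) :
    ((traversals p u v - 1 : ℕ) : ℝ≥0∞) ≤ ∑' z : List V × List V × List V,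
      if p = z.1 ++ u :: v :: (z.2.1 ++ u :: v :: z.2.2) then 1 else 0 := by
  obtain ⟨s, hs, hc⟩ := exists_finset_pairs_traversals huv p
  calc ((traversals p u v - 1 : ℕ) : ℝ≥0∞) ≤ (s.card : ℝ≥0∞) := by
        exact_mod_cast Nat.sub_le_iff_le_add.2 hc
    _ = ∑ z ∈ s, if p = z.1 ++ u :: v :: (z.2.1 ++ u :: v :: z.2.2) then 1 else 0 := by
        rw [Finset.sum_congr rfl (fun z hz => if_pos (hs z hz))]; simp
    _ ≤ _ := ENNReal.sum_le_tsum s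

open Classical in
-- A triple is recovered from the positions of the displayed `u` and `v` in the resulting path,
-- since these cut it into the prefix, the reversed middle and the suffix.
lemma tsum_decompositions_le (u v : V) (p : List V) :
    (∑' z : List V × List V × List V,
      if z.1 ++ u :: (z.2.1.reverse ++ v :: z.2.2) = p then (1 : ℝ≥0∞) else 0)
      ≤ (p.count u : ℝ≥0∞) * p.count v := by
  obtain ⟨s, hs, hsc⟩ := exists_finset_split u p
  obtain ⟨s', hs', hsc'⟩ := exists_finset_split v p
  let g : List V × List V × List V → (List V × List V) × (List V × List V) := fun z =>
    ((z.1, z.2.1.reverse ++ v :: z.2.2), (z.1 ++ u :: z.2.1.reverse, z.2.2))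
  have hg : Function.Injective g := by
    rintro ⟨a, b, d⟩ ⟨a', b', d'⟩ h
    simp only [g, Prod.mk.injEq] at h
    obtain ⟨⟨rfl, h⟩, h', rfl⟩ := h
    simpa using h
  calc _ ≤ ∑' z, (if g z ∈ s ×ˢ s' then (1 : ℝ≥0∞) else 0) := by
        refine ENNReal.tsum_le_tsum fun z => ?_
        split_ifs with h1 h2
        · exact le_rfl
        · refine absurd (Finset.mem_product.2 ⟨hs _ h1.symm, hs' _ ?_⟩) h2
          simp [g, ← h1]
        · simp
        · simp
    _ ≤ ∑' y, (if y ∈ s ×ˢ s' then (1 : ℝ≥0∞) else 0) :=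
        ENNReal.tsum_comp_le_tsum_of_injective hg _
    _ = ((s ×ˢ s').card : ℝ≥0∞) := by
        rw [tsum_eq_sum (s := s ×ˢ s') (fun y hy => if_neg hy)]
        rw [Finset.sum_congr rfl (fun z hz => if_pos hz)]; simp
    _ ≤ _ := by
        rw [Finset.card_product]
        exact_mod_cast Nat.mul_le_mul hsc hsc'

end Decompositions

/-- The density `l ^ (n - 1) / (n - 1)!` of the local time after `n` visits, up to an exponential
factor. -/
noncomputable def visitWeight (l : ℝ) (n : ℕ) : ℝ≥0∞ :=
  ENNReal.ofReal (l ^ (n - 1) / (n - 1).factorial)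

/-- The factorial gains exactly the factor `n`, which later cancels the count of decompositions. At
`n = 0` the truncated exponent would make this false. -/
lemma visitWeight_succ_mul {l : ℝ} (hl : 0 ≤ l) {n : ℕ} (hn : 1 ≤ n) :
    visitWeight l (n + 1) * n = ENNReal.ofReal l * visitWeight l n := by
  obtain ⟨k, rfl⟩ : ∃ k, n = k + 1 := ⟨n - 1, by omega⟩
  rw [visitWeight, visitWeight, ← ENNReal.ofReal_mul hl, ← ENNReal.ofReal_natCast,
    ← ENNReal.ofReal_mul (by positivity)]
  congr 1
  simp only [Nat.add_sub_cancel, Nat.factorial_succ]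
  push_cast
  field_simp
  ring

/-! ### The exchange argument and the bound on the number of visits. -/

section PathWeight

variable {V : Type*} [DecidableEq V] (N : Network V)

/-- The conductance between distinct vertices, with self-loops discarded. -/
noncomputable def Network.offDiag (x y : V) : ℝ≥0∞ :=
  if x = y then 0 else ENNReal.ofReal (N.c x y)

lemma Network.offDiag_symm (x y : V) : N.offDiag x y = N.offDiag y x := by
  simp [Network.offDiag, N.symm x y, eq_comm]

variable [Fintype V]

open Classical in
/-- The weight, proportional to its conditional probability given local times `l`, of a path. -/
noncomputable def Network.pathWeight (v₀ : V) (l : V → ℝ) (p : List V) : ℝ≥0∞ :=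
  if p.head? = some v₀ ∧ p.getLast? = some v₀ ∧ ∀ w, w ∈ p then
    stepWeight N.offDiag p * ∏ w, visitWeight (l w) (p.count w) else 0

/-- The exchange keeps both endpoints and the set of visited vertices, so the side conditions in the
weight agree. Only the counts of `u` and `v` change, each by one. -/
lemma Network.pathWeight_exchange {v₀ : V} {l : V → ℝ} (hl : ∀ w, 0 ≤ l w) {u v : V} (huv : u ≠ v)
    (α β γ : List V) :
    N.pathWeight v₀ l (α ++ u :: v :: (β ++ u :: v :: γ)) *
      ((α ++ u :: (β.reverse ++ v :: γ)).count u * (α ++ u :: (β.reverse ++ v :: γ)).count v)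
      = ENNReal.ofReal (l u * l v * N.c u v ^ 2) *
        N.pathWeight v₀ l (α ++ u :: (β.reverse ++ v :: γ)) := by
  set p := α ++ u :: v :: (β ++ u :: v :: γ) with hp
  set p' := α ++ u :: (β.reverse ++ v :: γ) with hp'
  have hcount : ∀ w, p.count w = p'.count w + ((if w = u then 1 else 0) + if w = v then 1 else 0) := by
    intro w
    simp only [hp, hp', List.count_append, List.count_cons, List.count_reverse, beq_iff_eq,
      @eq_comm _ _ w]
    omega
  have h1 : p.head? = p'.head? := by simp [hp, hp', List.head?_append]
  have h2 : p.getLast? = p'.getLast? := by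
    simp [hp, hp', List.getLast?_append, List.getLast?_cons]
  have h3 : (∀ w, w ∈ p) ↔ ∀ w, w ∈ p' := by
    refine forall_congr' fun w => ?_
    simp only [hp, hp', List.mem_append, List.mem_cons, List.mem_reverse]
    tauto
  unfold Network.pathWeight
  simp only [h1, h2, h3]
  split_ifs with h
  swap
  · simp
  have hpos : ∀ w, 1 ≤ p'.count w := fun w => List.count_pos_iff.2 (h.2.2 w)
  have hK : ENNReal.ofReal (l u * l v * N.c u v ^ 2)
      = N.offDiag u v ^ 2 * (ENNReal.ofReal (l u) * ENNReal.ofReal (l v)) := by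
    rw [Network.offDiag, if_neg huv, ENNReal.ofReal_mul (mul_nonneg (hl u) (hl v)),
      ENNReal.ofReal_mul (hl u), ENNReal.ofReal_pow (N.nonneg u v), mul_comm]
  have hprod : (∏ w, visitWeight (l w) (p.count w)) * (p'.count u * p'.count v)
      = (ENNReal.ofReal (l u) * ENNReal.ofReal (l v)) * ∏ w, visitWeight (l w) (p'.count w) := by
    have e1 : ∀ (f : V → ℝ≥0∞) (a : V), f a = ∏ w, if w = a then f w else 1 := by
      intro f a; simp
    rw [e1 (fun w => (p'.count w : ℝ≥0∞)) u, e1 (fun w => (p'.count w : ℝ≥0∞)) v,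
      e1 (fun w => ENNReal.ofReal (l w)) u, e1 (fun w => ENNReal.ofReal (l w)) v,
      ← Finset.prod_mul_distrib, ← Finset.prod_mul_distrib, ← Finset.prod_mul_distrib,
      ← Finset.prod_mul_distrib]
    refine Finset.prod_congr rfl fun w _ => ?_
    rw [hcount w]
    by_cases hu : w = u
    · have hv : w ≠ v := hu ▸ huv
      simpa [hu, hv, huv] using visitWeight_succ_mul (hl u) (hpos u)
    · by_cases hv : w = v
      · simpa [hu, hv, huv, huv.symm] using visitWeight_succ_mul (hl v) (hpos v)
      · simp [hu, hv]
  have hs : stepWeight N.offDiag p = N.offDiag u v ^ 2 * stepWeight N.offDiag p' :=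
    stepWeight_exchange _ N.offDiag_symm α β γ u v
  rw [hs, mul_assoc, hprod, hK]
  ring

open Classical in
-- Double counting: the excess is at most the number of pairs of traversals, each pair is exchanged
-- for a shorter path, and the multiplicity of that path is absorbed by the denominator from
-- `pathWeight_exchange`.
lemma Network.tsum_pathWeight_mul_traversals_le {v₀ : V} {l : V → ℝ} (hl : ∀ w, 0 ≤ l w)
    {u v : V} (huv : u ≠ v) :
    ∑' p, N.pathWeight v₀ l p * ((traversals p u v - 1 : ℕ) : ℝ≥0∞)
      ≤ ENNReal.ofReal (l u * l v * N.c u v ^ 2) * ∑' p, N.pathWeight v₀ l p := by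
  set K := ENNReal.ofReal (l u * l v * N.c u v ^ 2) with hKdef
  set D := N.pathWeight v₀ l with hD
  let Φ : List V × List V × List V → List V := fun z => z.1 ++ u :: v :: (z.2.1 ++ u :: v :: z.2.2)
  let Ψ : List V × List V × List V → List V := fun z => z.1 ++ u :: (z.2.1.reverse ++ v :: z.2.2)
  let n : List V → ℝ≥0∞ := fun p => p.count u * p.count v
  have hn0 : ∀ z, n (Ψ z) ≠ 0 := by
    intro z
    have h1 : (Ψ z).count u ≠ 0 := by simp [Ψ]
    have h2 : (Ψ z).count v ≠ 0 := (List.count_pos_iff.2 (by simp [Ψ])).ne'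
    exact mul_ne_zero (by exact_mod_cast h1) (by exact_mod_cast h2)
  have hnt : ∀ p, n p ≠ ⊤ := fun p => ENNReal.mul_ne_top (by simp) (by simp)
  have key : ∀ z, D (Φ z) = K * D (Ψ z) / n (Ψ z) := fun z =>
    (ENNReal.eq_div_iff (hn0 z) (hnt _)).2 (by
      rw [mul_comm]; exact N.pathWeight_exchange hl huv z.1 z.2.1 z.2.2)
  calc _ ≤ ∑' p, D p * ∑' z, (if p = Φ z then (1 : ℝ≥0∞) else 0) :=
        ENNReal.tsum_le_tsum fun p => mul_le_mul_right (traversals_sub_one_le_tsum huv p) _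
    _ = ∑' z, D (Φ z) := by
        simp_rw [← ENNReal.tsum_mul_left]
        rw [ENNReal.tsum_comm]
        refine tsum_congr fun z => ?_
        simp
    _ = ∑' p, K * D p / n p * ∑' z, (if Ψ z = p then (1 : ℝ≥0∞) else 0) := by
        simp_rw [← ENNReal.tsum_mul_left]
        rw [ENNReal.tsum_comm]
        refine tsum_congr fun z => ?_
        rw [tsum_eq_single (Ψ z) (fun p hp => by simp [hp.symm]), key]
        simp
    _ ≤ ∑' p, K * D p := by
        refine ENNReal.tsum_le_tsum fun p => ?_
        refine (mul_le_mul_right (tsum_decompositions_le u v p) _).trans ?_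
        rw [ENNReal.div_eq_inv_mul, mul_comm, ← mul_assoc]
        exact mul_le_of_le_one_left zero_le (ENNReal.mul_inv_le_one _)
    _ = _ := ENNReal.tsum_mul_left

/-- Markov's inequality for the total excess over the neighbours, whose weighted sum is at most `d /
16` times the total weight. -/
lemma Network.tsum_pathWeight_le {v₀ v : V} {l : V → ℝ} (hl : ∀ w, 0 ≤ l w)
    (hthin : ∀ u ∈ N.nbrs v, l u * l v * N.c u v ^ 2 ≤ 1 / 16) :
    2 * ∑' p, {p | ¬ N.visits p v ≤ 1118 * (N.nbrs v).card}.indicator (N.pathWeight v₀ l) p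
      ≤ ∑' p, N.pathWeight v₀ l p := by
  set D := N.pathWeight v₀ l with hD
  set d := (N.nbrs v).card with hd
  rcases Nat.eq_zero_or_pos d with h0 | hdpos
  · have : ∀ p, N.visits p v ≤ 1118 * d := by
      intro p
      have : N.nbrs v = ∅ := Finset.card_eq_zero.1 (hd ▸ h0)
      simp [Network.visits, this]
    simp [this]
  have hbad : ∀ p, (d : ℝ≥0∞) * {p | ¬ N.visits p v ≤ 1118 * d}.indicator D p
      ≤ ∑ u ∈ N.nbrs v, D p * ((traversals p u v - 1 : ℕ) : ℝ≥0∞) := by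
    intro p
    by_cases hp : N.visits p v ≤ 1118 * d
    · rw [Set.indicator_of_notMem (by simpa using hp)]; simp
    · rw [Set.indicator_of_mem (by simpa using hp), ← Finset.mul_sum, mul_comm]
      refine mul_le_mul_right ?_ _
      have h1 : N.visits p v ≤ ∑ u ∈ N.nbrs v, (traversals p u v - 1) + d := by
        rw [Network.visits, hd, Finset.card_eq_sum_ones, ← Finset.sum_add_distrib]
        exact Finset.sum_le_sum fun u _ => by omega
      -- More than `1118 * d` visits force a total excess above `1117 * d`; only `d` is used, so the
      -- constant has ample slack.
      have h2 : d ≤ ∑ u ∈ N.nbrs v, (traversals p u v - 1) := by omega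
      exact_mod_cast h2
  have hsum : (d : ℝ≥0∞) * ∑' p, {p | ¬ N.visits p v ≤ 1118 * d}.indicator D p
      ≤ (d : ℝ≥0∞) * (ENNReal.ofReal (1 / 16) * ∑' p, D p) := by
    rw [← ENNReal.tsum_mul_left]
    refine (ENNReal.tsum_le_tsum hbad).trans ?_
    rw [Summable.tsum_finsetSum (fun _ _ => ENNReal.summable)]
    calc _ ≤ ∑ u ∈ N.nbrs v, ENNReal.ofReal (1 / 16) * ∑' p, D p := by
          refine Finset.sum_le_sum fun u hu => ?_
          have huv : u ≠ v := by simp [Network.nbrs] at hu; exact hu.1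
          exact (N.tsum_pathWeight_mul_traversals_le hl huv).trans
            (mul_le_mul_left (ENNReal.ofReal_le_ofReal (hthin u hu)) _)
      _ = _ := by simp [hd]
  have hsum' := (ENNReal.mul_le_mul_iff_right (by exact_mod_cast hdpos.ne')
    (ENNReal.natCast_ne_top d)).1 hsum
  calc _ ≤ 2 * (ENNReal.ofReal (1 / 16) * ∑' p, D p) := mul_le_mul_right hsum' _
    _ = ENNReal.ofReal (1 / 8) * ∑' p, D p := by
        rw [← mul_assoc]; congr 1
        rw [← ENNReal.ofReal_ofNat, ← ENNReal.ofReal_mul (by norm_num)]; norm_num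
    _ ≤ 1 * ∑' p, D p := mul_le_mul_left (by
        rw [← ENNReal.ofReal_one]; exact ENNReal.ofReal_le_ofReal (by norm_num)) _
    _ = _ := one_mul _

end PathWeight

/-! ### Jump times of a single right-continuous trajectory. -/

section Trajectories

variable {V : Type*} {x : ℝ≥0 → V}

/-- The vertex visited at the `k`-th jump time. -/
noncomputable def jumpState (x : ℝ≥0 → V) (k : ℕ) : V := x (jumpTime x k).toNNReal

lemma jumpTime_succ_le {k : ℕ} {r : ℝ≥0} (h : jumpTime x k < r) (hr : x r ≠ jumpState x k) :
    jumpTime x (k + 1) ≤ r := by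
  rw [jumpTime]
  exact iInf₂_le r ⟨h, hr⟩

lemma le_jumpTime_succ {k : ℕ} {a : ℝ≥0∞}
    (h : ∀ r : ℝ≥0, jumpTime x k < r → x r ≠ jumpState x k → a ≤ r) :
    a ≤ jumpTime x (k + 1) := by
  rw [jumpTime]
  exact le_iInf₂ fun r hr => h r hr.1 hr.2

lemma jumpTime_le_succ (x : ℝ≥0 → V) (k : ℕ) : jumpTime x k ≤ jumpTime x (k + 1) :=
  le_jumpTime_succ fun _ h _ => h.le

lemma eq_jumpState {k : ℕ} {r : ℝ≥0} (h : jumpTime x k ≤ r) (hr : r < jumpTime x (k + 1)) :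
    x r = jumpState x k := by
  rcases h.eq_or_lt with h | h
  · rw [jumpState, h, ENNReal.toNNReal_coe]
  · by_contra hne
    exact absurd (jumpTime_succ_le h hne) (not_le.2 hr)

lemma exists_forall_lt_of_eventually {s : ℝ≥0} {P : ℝ≥0 → Prop} (h : ∀ᶠ r in 𝓝[>] s, P r) :
    ∃ δ : ℝ≥0, s < δ ∧ ∀ r, s < r → r < δ → P r := by
  obtain ⟨δ, hδ, hP⟩ := (mem_nhdsGT_iff_exists_Ioo_subset' (show s < s + 1 by simp)).1 h
  exact ⟨δ, hδ, fun r h1 h2 => hP ⟨h1, h2⟩⟩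

lemma jumpTime_lt_succ (hr : ∀ s, ∀ᶠ r in 𝓝[>] s, x r = x s) {k : ℕ} (hk : jumpTime x k ≠ ⊤) :
    jumpTime x k < jumpTime x (k + 1) := by
  obtain ⟨δ, hδ, hP⟩ := exists_forall_lt_of_eventually (hr (jumpTime x k).toNNReal)
  have e : jumpTime x k = ((jumpTime x k).toNNReal : ℝ≥0∞) := (ENNReal.coe_toNNReal hk).symm
  refine lt_of_lt_of_le (b := (δ : ℝ≥0∞)) (by rw [e]; exact_mod_cast hδ) ?_
  refine le_jumpTime_succ fun r h1 h2 => ?_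
  by_contra hlt
  refine h2 (hP r ?_ (by exact_mod_cast not_le.1 hlt))
  rw [e] at h1
  exact_mod_cast h1

/-- If the two states agreed, right-continuity would keep the old state for a while after the jump
time, so the infimum defining that time would be larger. -/
lemma jumpState_ne_succ (hr : ∀ s, ∀ᶠ r in 𝓝[>] s, x r = x s) {k : ℕ}
    (hk : jumpTime x (k + 1) ≠ ⊤) : jumpState x k ≠ jumpState x (k + 1) := by
  intro heq
  obtain ⟨δ, hδ, hP⟩ := exists_forall_lt_of_eventually (hr (jumpTime x (k + 1)).toNNReal)
  have e : jumpTime x (k + 1) = ((jumpTime x (k + 1)).toNNReal : ℝ≥0∞) :=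
    (ENNReal.coe_toNNReal hk).symm
  have : (δ : ℝ≥0∞) ≤ jumpTime x (k + 1) := by
    refine le_jumpTime_succ fun r h1 h2 => ?_
    by_contra hlt
    have hle := jumpTime_succ_le h1 h2
    rw [e] at hle
    rcases (show (jumpTime x (k + 1)).toNNReal ≤ r by exact_mod_cast hle).eq_or_lt with h | h
    · exact h2 (by rw [heq, jumpState, h])
    · exact h2 (by rw [heq, jumpState]; exact hP r h (by exact_mod_cast not_le.1 hlt))
  rw [e] at this
  exact absurd (show δ ≤ _ by exact_mod_cast this) (not_le.2 hδ)

/-- A right-continuous trajectory with infinitely many jumps and without explosion. -/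
structure RegularTrajectory (x : ℝ≥0 → V) : Prop where
  rightCont : ∀ s, ∀ᶠ r in 𝓝[>] s, x r = x s
  ne_top : ∀ k, jumpTime x k ≠ ⊤
  unbounded : ∀ s : ℝ≥0, ∃ k, (s : ℝ≥0∞) < jumpTime x k

/-- The indicator of the times that a trajectory spends at `w`. -/
noncomputable def stayIndicator [DecidableEq V] (x : ℝ≥0 → V) (w : V) (r : ℝ) : ℝ :=
  if x r.toNNReal = w then (1 : ℝ) else 0

namespace RegularTrajectory

variable (hx : RegularTrajectory x)
include hx

lemma toReal_lt (k : ℕ) : (jumpTime x k).toReal < (jumpTime x (k + 1)).toReal :=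
  (ENNReal.toReal_lt_toReal (hx.ne_top _) (hx.ne_top _)).2
    (jumpTime_lt_succ hx.rightCont (hx.ne_top k))

lemma strictMono : StrictMono fun k => (jumpTime x k).toReal :=
  strictMono_nat_of_lt_succ hx.toReal_lt

lemma eq_jumpState_toNNReal {k : ℕ} {r : ℝ} (h1 : (jumpTime x k).toReal ≤ r)
    (h2 : r < (jumpTime x (k + 1)).toReal) : x r.toNNReal = jumpState x k := by
  have h0 : 0 ≤ r := ENNReal.toReal_nonneg.trans h1
  refine eq_jumpState ?_ ?_
  · rw [← ENNReal.ofReal_toReal (hx.ne_top k)]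
    exact ENNReal.ofReal_le_ofReal h1
  · rw [← ENNReal.ofReal_toReal (hx.ne_top (k + 1))]
    exact (ENNReal.ofReal_lt_ofReal_iff (h0.trans_lt h2)).2 h2

lemma exists_lt_jumpTime (s : ℝ) : ∃ k, s < (jumpTime x k).toReal := by
  obtain ⟨k, hk⟩ := hx.unbounded s.toNNReal
  refine ⟨k, ?_⟩
  have := (ENNReal.ofReal_lt_iff_lt_toReal (le_max_right s 0) (hx.ne_top k)).1
    (by simpa [ENNReal.ofReal, Real.toNNReal] using hk)
  exact (le_max_left _ _).trans_lt this

end RegularTrajectory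

end Trajectories

/-! ### Local times and the inverse local time of a regular trajectory. -/

section LocalTimes

variable {V : Type*} [Fintype V] [DecidableEq V] (N : Network V) {x : ℝ≥0 → V}

/-- The local time accumulated during the `k`-th stay of a trajectory. -/
noncomputable def Network.holding (x : ℝ≥0 → V) (k : ℕ) : ℝ :=
  ((jumpTime x (k + 1)).toReal - (jumpTime x k).toReal) / N.total (jumpState x k)

/-- The local time at `w` accumulated during the first `n` stays of a trajectory. -/
noncomputable def Network.stayTime (x : ℝ≥0 → V) (n : ℕ) (w : V) : ℝ :=
  ∑ i ∈ Finset.range n, if jumpState x i = w then N.holding x i else 0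

namespace RegularTrajectory

variable (hx : RegularTrajectory x)
include hx

omit [Fintype V] in
lemma stayIndicator_stay {k : ℕ} {s : ℝ} (h2 : s ≤ (jumpTime x (k + 1)).toReal)
    (h1 : (jumpTime x k).toReal ≤ s) (w : V) :
    IntervalIntegrable (stayIndicator x w) volume (jumpTime x k).toReal s ∧
      ∫ r in (jumpTime x k).toReal..s, stayIndicator x w r
        = if jumpState x k = w then s - (jumpTime x k).toReal else 0 := by
  have hae : ∀ᵐ r ∂(volume : Measure ℝ), r ∈ Set.uIoc (jumpTime x k).toReal s →
      (if jumpState x k = w then (1 : ℝ) else 0) = stayIndicator x w r := by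
    -- The endpoint may itself be the next jump time, where the state has already changed; one point
    -- does not affect the integral.
    have : ∀ᵐ r ∂(volume : Measure ℝ), r ≠ s := by
      simp [ae_iff]
    filter_upwards [this] with r hr hmem
    rw [Set.uIoc_of_le h1] at hmem
    rw [stayIndicator, hx.eq_jumpState_toNNReal hmem.1.le
      (lt_of_lt_of_le (lt_of_le_of_ne hmem.2 hr) h2)]
  constructor
  · exact (intervalIntegrable_const (c := if jumpState x k = w then (1 : ℝ) else 0)).congr_ae
      ((ae_restrict_iff' measurableSet_uIoc).2 hae)
  · rw [← intervalIntegral.integral_congr_ae hae]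
    split_ifs <;> simp

lemma stayIndicator_jumpTime (hpos : ∀ w, 0 < N.total w) (n : ℕ) (w : V) :
    IntervalIntegrable (stayIndicator x w) volume 0 (jumpTime x n).toReal ∧
      ∫ r in (0 : ℝ)..(jumpTime x n).toReal, stayIndicator x w r
        = N.total w * N.stayTime x n w := by
  induction n with
  | zero => simp [jumpTime, Network.stayTime]
  | succ n ih =>
    obtain ⟨i1, i2⟩ := hx.stayIndicator_stay (le_refl (jumpTime x (n + 1)).toReal)
      (hx.toReal_lt n).le w
    refine ⟨ih.1.trans i1, ?_⟩
    rw [← intervalIntegral.integral_add_adjacent_intervals ih.1 i1, ih.2, i2, Network.stayTime,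
      Network.stayTime, Finset.sum_range_succ, mul_add]
    congr 1
    split_ifs with h
    · rw [Network.holding, h, mul_div_cancel₀ _ (hpos w).ne']
    · simp

lemma intervalIntegrable (hpos : ∀ w, 0 < N.total w) (w : V) {a b : ℝ} (ha : 0 ≤ a) (hb : 0 ≤ b) :
    IntervalIntegrable (stayIndicator x w) volume a b := by
  obtain ⟨k, hk⟩ := hx.exists_lt_jumpTime (max a b)
  refine (hx.stayIndicator_jumpTime N hpos k w).1.mono_set ?_
  rw [Set.uIcc_of_le (ENNReal.toReal_nonneg)]
  exact Set.uIcc_subset_Icc ⟨ha, (le_max_left _ _).trans hk.le⟩ ⟨hb, (le_max_right _ _).trans hk.le⟩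

lemma localTime_mono (hpos : ∀ w, 0 < N.total w) (w : V) {a b : ℝ} (ha : 0 ≤ a) (hab : a ≤ b) :
    N.localTime x w a ≤ N.localTime x w b := by
  have hadd := intervalIntegral.integral_add_adjacent_intervals
    (hx.intervalIntegrable N hpos w le_rfl ha) (hx.intervalIntegrable N hpos w ha (ha.trans hab))
  have hnn : 0 ≤ ∫ r in a..b, stayIndicator x w r :=
    intervalIntegral.integral_nonneg hab fun r _ => by unfold stayIndicator; split_ifs <;> simp
  have : ∫ r in (0:ℝ)..a, stayIndicator x w r ≤ ∫ r in (0:ℝ)..b, stayIndicator x w r := by linarith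
  exact mul_le_mul_of_nonneg_left this (one_div_nonneg.2 (hpos w).le)

lemma localTime_eq (hpos : ∀ w, 0 < N.total w) (w : V) {n : ℕ} {s : ℝ}
    (h1 : (jumpTime x n).toReal ≤ s) (h2 : s ≤ (jumpTime x (n + 1)).toReal) :
    N.localTime x w s = N.stayTime x n w +
      if jumpState x n = w then (s - (jumpTime x n).toReal) / N.total w else 0 := by
  have hadd := intervalIntegral.integral_add_adjacent_intervals
    (hx.stayIndicator_jumpTime N hpos n w).1 (hx.stayIndicator_stay h2 h1 w).1
  rw [(hx.stayIndicator_jumpTime N hpos n w).2, (hx.stayIndicator_stay h2 h1 w).2] at hadd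
  have : N.localTime x w s = 1 / N.total w * ∫ r in (0:ℝ)..s, stayIndicator x w r := rfl
  rw [this, ← hadd]
  have := (hpos w).ne'
  split_ifs
  · field_simp
  · field_simp
    ring

/-- During a stay at `v₀` the local time there is affine with slope `1 / c_{v₀}`, so the level `t`
is crossed at an explicit time. The strict inequality puts that time before the next jump. -/
lemma invLocalTime_eq (hpos : ∀ w, 0 < N.total w) {v₀ : V} {t : ℝ} {n : ℕ}
    (hn : jumpState x n = v₀) (h1 : N.stayTime x n v₀ ≤ t)
    (h2 : t < N.stayTime x n v₀ + N.holding x n) :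
    N.invLocalTime v₀ x t = ENNReal.ofReal
      ((jumpTime x n).toReal + N.total v₀ * (t - N.stayTime x n v₀)) := by
  set σ := (jumpTime x n).toReal + N.total v₀ * (t - N.stayTime x n v₀) with hσ
  have hc := hpos v₀
  have hσ1 : (jumpTime x n).toReal ≤ σ := by
    have : 0 ≤ N.total v₀ * (t - N.stayTime x n v₀) := mul_nonneg hc.le (by linarith)
    linarith
  have hσ0 : 0 ≤ σ := ENNReal.toReal_nonneg.trans hσ1
  have hσ2 : σ < (jumpTime x (n + 1)).toReal := by
    have : t - N.stayTime x n v₀ < N.holding x n := by linarith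
    rw [Network.holding, hn, lt_div_iff₀ hc] at this
    linarith
  have hloc : ∀ s, (jumpTime x n).toReal ≤ s → s ≤ (jumpTime x (n + 1)).toReal →
      N.localTime x v₀ s = t + (s - σ) / N.total v₀ := by
    intro s hs1 hs2
    rw [hx.localTime_eq N hpos v₀ hs1 hs2, if_pos hn, hσ]
    field_simp
    ring
  apply le_antisymm
  · refine le_of_forall_gt_imp_ge_of_dense fun b hb => ?_
    -- The test time is kept within the current stay, where the affine formula is available.
    obtain ⟨b', hb1, hb2⟩ := exists_between
      (lt_min hb ((ENNReal.ofReal_lt_ofReal_iff (hσ0.trans_lt hσ2)).2 hσ2))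
    have hbt : b' ≠ ⊤ := (hb2.trans_le (min_le_right _ _)).ne_top
    have hb3 : σ < b'.toReal := (ENNReal.ofReal_lt_iff_lt_toReal hσ0 hbt).1 hb1
    have hb4 : b'.toReal ≤ (jumpTime x (n + 1)).toReal :=
      ENNReal.toReal_le_of_le_ofReal ENNReal.toReal_nonneg (hb2.le.trans (min_le_right _ _))
    have : N.invLocalTime v₀ x t ≤ (b'.toNNReal : ℝ≥0∞) := by
      refine iInf₂_le b'.toNNReal ?_
      change t < N.localTime x v₀ b'.toReal
      rw [hloc _ (hσ1.trans hb3.le) hb4]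
      have := div_pos (sub_pos.2 hb3) hc
      linarith
    rw [ENNReal.coe_toNNReal hbt] at this
    exact this.trans (hb2.le.trans (min_le_left _ _))
  · refine le_iInf₂ fun s hs => ?_
    by_contra hlt
    have hsσ : (s : ℝ) < σ := by
      have := (ENNReal.lt_ofReal_iff_toReal_lt ENNReal.coe_ne_top).1 (not_le.1 hlt)
      simpa using this
    have h := hx.localTime_mono N hpos v₀ s.2 hsσ.le
    rw [hloc σ hσ1 hσ2.le] at h
    simp only [sub_self, zero_div, add_zero] at h
    exact absurd hs (not_lt.2 h)

/-- The path and the local times when the walk stands at `v₀` in its `n`-th stay at the inverse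
local time. -/
lemma embeddedPath_and_localTimesAt (hpos : ∀ w, 0 < N.total w) {v₀ : V} {t : ℝ} {n : ℕ}
    (hn : jumpState x n = v₀) (h1 : N.stayTime x n v₀ ≤ t)
    (h2 : t < N.stayTime x n v₀ + N.holding x n) :
    N.embeddedPath v₀ t x = (List.range (n + 1)).map (jumpState x) ∧
      N.localTimesAt v₀ t x = Function.update (N.stayTime x n) v₀ t := by
  have hc := hpos v₀
  have hinv := hx.invLocalTime_eq N hpos hn h1 h2
  set σ := (jumpTime x n).toReal + N.total v₀ * (t - N.stayTime x n v₀) with hσ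
  have hσ1 : (jumpTime x n).toReal ≤ σ := by
    have : 0 ≤ N.total v₀ * (t - N.stayTime x n v₀) := mul_nonneg hc.le (by linarith)
    linarith
  have hσ0 : 0 ≤ σ := ENNReal.toReal_nonneg.trans hσ1
  have hσ2 : σ < (jumpTime x (n + 1)).toReal := by
    have : t - N.stayTime x n v₀ < N.holding x n := by linarith
    rw [Network.holding, hn, lt_div_iff₀ hc] at this
    linarith
  have hiff : ∀ k, jumpTime x k ≤ N.invLocalTime v₀ x t ↔ k ≤ n := by
    intro k
    rw [hinv, ENNReal.le_ofReal_iff_toReal_le (hx.ne_top k) hσ0]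
    constructor
    · intro h
      by_contra hk
      exact absurd ((hx.strictMono.monotone (not_le.1 hk : n + 1 ≤ k)).trans h) (not_le.2 hσ2)
    · exact fun h => (hx.strictMono.monotone h).trans hσ1
  have hnum : N.numJumps v₀ t x = n := by
    have : {k : ℕ | jumpTime x k ≤ N.invLocalTime v₀ x t} = Set.Iic n := by
      ext k; exact hiff k
    rw [Network.numJumps, this, csSup_Iic]
  refine ⟨by rw [Network.embeddedPath, hnum]; rfl, ?_⟩
  funext w
  rw [Network.localTimesAt, hinv, ENNReal.toReal_ofReal hσ0, hx.localTime_eq N hpos w hσ1 hσ2.le]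
  by_cases hw : w = v₀
  · subst hw
    rw [if_pos hn, Function.update_self, hσ]
    field_simp
    ring
  · rw [if_neg (fun h => hw (h.symm.trans hn)), Function.update_of_ne hw, add_zero]

/-- At the first index where the completed stays exceed `t`, the stay just added must be at `v₀`,
since no other stay increases the local time there. -/
lemma exists_stay (hpos : ∀ w, 0 < N.total w) {v₀ : V} {t : ℝ} (ht : 0 ≤ t)
    (h : N.invLocalTime v₀ x t ≠ ⊤) :
    ∃ n, jumpState x n = v₀ ∧ N.stayTime x n v₀ ≤ t ∧
      t < N.stayTime x n v₀ + N.holding x n := by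
  obtain ⟨s, hs⟩ : ∃ s : ℝ≥0, t < N.localTime x v₀ s := by
    by_contra! hcon
    exact h (by simp [Network.invLocalTime, not_lt.2 (hcon _)])
  have hex : ∃ k, t < N.stayTime x k v₀ := by
    obtain ⟨k, hk⟩ := hx.exists_lt_jumpTime s
    refine ⟨k, hs.trans_le ?_⟩
    have h1 := hx.localTime_mono N hpos v₀ s.2 hk.le
    rw [hx.localTime_eq N hpos v₀ le_rfl (hx.toReal_lt k).le] at h1
    simpa using h1
  classical
  obtain ⟨m, hm⟩ : ∃ m, Nat.find hex = m + 1 := by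
    refine Nat.exists_eq_succ_of_ne_zero fun h0 => ?_
    have := Nat.find_spec hex
    rw [h0] at this
    simp only [Network.stayTime, Finset.range_zero, Finset.sum_empty] at this
    linarith
  have h1 : N.stayTime x m v₀ ≤ t := not_lt.1 (Nat.find_min hex (by omega))
  have h2 : t < N.stayTime x (m + 1) v₀ := hm ▸ Nat.find_spec hex
  rw [Network.stayTime, Finset.sum_range_succ, ← Network.stayTime] at h2
  by_cases hs : jumpState x m = v₀
  · rw [if_pos hs] at h2
    exact ⟨m, hs, h1, h2⟩
  · rw [if_neg hs] at h2
    linarith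

end RegularTrajectory

end LocalTimes

/-! ### Measurability of jump times, jump states and holding times. -/

section Measurability

variable {V Ω : Type*} [MeasurableSpace Ω] {X : ℝ≥0 → Ω → V}

/-- By right-continuity the state at `T` is the eventual state along grid times decreasing to `T`
strictly from the right, and each grid time takes countably many values. -/
lemma measurableSet_eq_of_rightCont (hm : ∀ s w, MeasurableSet {ω | X s ω = w})
    (hr : ∀ ω s, ∀ᶠ r in 𝓝[>] s, X r ω = X s ω) {T : Ω → ℝ≥0} (hT : Measurable T) (w : V) :
    MeasurableSet {ω | X (T ω) ω = w} := by
  let d : ℕ → ℕ → ℝ≥0 := fun n m => (m + 1) / (n + 1)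
  let f : ℕ → Ω → ℕ := fun n ω => ⌊T ω * (n + 1)⌋₊
  have hf : ∀ n, Measurable (f n) := fun n => Nat.measurable_floor.comp (hT.mul_const _)
  have hgt : ∀ n ω, T ω < d n (f n ω) := by
    intro n ω
    rw [lt_div_iff₀ (by positivity)]
    exact Nat.lt_floor_add_one _
  have hle : ∀ n ω, d n (f n ω) ≤ T ω + 1 / (n + 1) := by
    intro n ω
    simp only [d]
    rw [add_div]
    gcongr
    rw [div_le_iff₀ (by positivity)]
    exact Nat.floor_le zero_le
  have hlim : ∀ ω, Tendsto (fun n => d n (f n ω)) atTop (𝓝[>] (T ω)) := by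
    intro ω
    refine tendsto_nhdsWithin_iff.2 ⟨?_, Eventually.of_forall fun n => hgt n ω⟩
    refine tendsto_of_tendsto_of_tendsto_of_le_of_le tendsto_const_nhds ?_
      (fun n => (hgt n ω).le) (fun n => hle n ω)
    have : Tendsto (fun n : ℕ => 1 / ((n : ℝ≥0) + 1)) atTop (𝓝 0) :=
      tendsto_one_div_add_atTop_nhds_zero_nat
    simpa using this.const_add (T ω)
  have hset : {ω | X (T ω) ω = w} =
      {ω | ∃ n₀, ∀ n ≥ n₀, ∃ m, f n ω = m ∧ X (d n m) ω = w} := by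
    ext ω
    have h1 := (hlim ω).eventually (hr ω (T ω))
    obtain ⟨n₁, hn₁⟩ := eventually_atTop.1 h1
    simp only [Set.mem_ofPred_eq, exists_eq_left']
    constructor
    · intro h
      exact ⟨n₁, fun n hn => (hn₁ n hn).trans h⟩
    · rintro ⟨n₀, hn₀⟩
      exact (hn₁ (max n₀ n₁) (le_max_right _ _)).symm.trans (hn₀ _ (le_max_left _ _))
  rw [hset]
  simp only [Set.ofPred_exists, Set.ofPred_forall]
  refine MeasurableSet.iUnion fun n₀ => MeasurableSet.iInter fun n => MeasurableSet.iInter fun _ =>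
    MeasurableSet.iUnion fun m => ?_
  exact ((hf n) (measurableSet_singleton m)).inter (hm _ _)

variable [Countable V]

/-- A state different from the old one persists briefly to the right, so the infimum can be tested
on a countable dense set of times. -/
lemma measurable_jumpTime (hm : ∀ s w, MeasurableSet {ω | X s ω = w})
    (hr : ∀ ω s, ∀ᶠ r in 𝓝[>] s, X r ω = X s ω) (k : ℕ) :
    Measurable fun ω => jumpTime (fun s => X s ω) k := by
  induction k with
  | zero => exact measurable_const
  | succ k ih =>
    obtain ⟨D, hD, hDd⟩ := TopologicalSpace.exists_countable_dense ℝ≥0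
    have hst : ∀ w, MeasurableSet {ω | jumpState (fun s => X s ω) k = w} := fun w =>
      measurableSet_eq_of_rightCont hm hr ih.ennreal_toNNReal w
    refine measurable_of_Iio fun a => ?_
    have hset : (fun ω => jumpTime (fun s => X s ω) (k + 1)) ⁻¹' Set.Iio a =
        ⋃ r ∈ D, ⋃ w, {ω | (r : ℝ≥0∞) < a ∧ jumpTime (fun s => X s ω) k < r ∧
          jumpState (fun s => X s ω) k = w ∧ ¬ X r ω = w} := by
      ext ω
      simp only [Set.mem_preimage, Set.mem_Iio, Set.mem_iUnion, Set.mem_ofPred_eq, exists_prop]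
      constructor
      · intro h
        obtain ⟨r, hr1, hr2, hr3⟩ : ∃ r : ℝ≥0, jumpTime (fun s => X s ω) k < r ∧
            X r ω ≠ jumpState (fun s => X s ω) k ∧ (r : ℝ≥0∞) < a := by
          by_contra! hcon
          exact absurd (le_jumpTime_succ fun r h1 h2 => hcon r h1 h2) (not_le.2 h)
        obtain ⟨b, hb1, hb2⟩ := ENNReal.lt_iff_exists_nnreal_btwn.1 hr3
        obtain ⟨δ, hδ, hP⟩ := exists_forall_lt_of_eventually (hr ω r)
        obtain ⟨q, hqD, hq1, hq2⟩ := hDd.exists_between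
          (lt_min hδ (show r < b by exact_mod_cast hb1))
        refine ⟨q, hqD, _, lt_trans ?_ hb2, hr1.trans ?_, rfl, ?_⟩
        · exact_mod_cast hq2.trans_le (min_le_right _ _)
        · exact_mod_cast hq1
        · rw [hP q hq1 (hq2.trans_le (min_le_left _ _))]
          exact hr2
      · rintro ⟨r, -, w, h1, h2, rfl, h3⟩
        exact (jumpTime_succ_le h2 h3).trans_lt h1
    rw [hset]
    refine MeasurableSet.biUnion hD fun r _ => MeasurableSet.iUnion fun w => ?_
    exact (MeasurableSet.const _).inter ((measurableSet_lt ih measurable_const).inter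
      ((hst w).inter (hm r w).compl))

lemma measurableSet_jumpState (hm : ∀ s w, MeasurableSet {ω | X s ω = w})
    (hr : ∀ ω s, ∀ᶠ r in 𝓝[>] s, X r ω = X s ω) (k : ℕ) (w : V) :
    MeasurableSet {ω | jumpState (fun s => X s ω) k = w} :=
  measurableSet_eq_of_rightCont hm hr (measurable_jumpTime hm hr k).ennreal_toNNReal w

lemma measurable_holding [Fintype V] (N : Network V) (hm : ∀ s w, MeasurableSet {ω | X s ω = w})
    (hr : ∀ ω s, ∀ᶠ r in 𝓝[>] s, X r ω = X s ω) (k : ℕ) :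
    Measurable fun ω => N.holding (fun s => X s ω) k := by
  let _ : MeasurableSpace V := ⊤
  have h : Measurable fun ω => jumpState (fun s => X s ω) k :=
    measurable_to_countable' fun w => measurableSet_jumpState hm hr k w
  exact ((measurable_jumpTime hm hr (k + 1)).ennreal_toReal.sub
    (measurable_jumpTime hm hr k).ennreal_toReal).div
    ((measurable_from_top (f := N.total)).comp h)

end Measurability

/-! ### The jump chain and its holding times. -/

section PathSums

variable {V : Type*} [Fintype V] [DecidableEq V]

/-- The extension to `ℕ` of a path indexed by `Fin (n + 1)`. -/
def natPath {n : ℕ} (y : Fin (n + 1) → V) (i : ℕ) : V := y (Fin.ofNat (n + 1) i)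

omit [Fintype V] [DecidableEq V] in
lemma natPath_val {n : ℕ} (y : Fin (n + 1) → V) (i : Fin (n + 1)) : natPath y i = y i := by
  simp [natPath]

lemma sum_prod_stochastic {p : V → V → ℝ≥0∞} (hp : ∀ x, ∑ y, p x y = 1) (v₀ : V) (n : ℕ) :
    ∑ y : Fin (n + 1) → V, (if y 0 = v₀ then 1 else 0) *
      ∏ i : Fin n, p (y i.castSucc) (y i.succ) = 1 := by
  induction n with
  | zero =>
    rw [Fintype.sum_equiv (Equiv.funUnique (Fin 1) V) _ (fun a => if a = v₀ then 1 else 0)]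
    · simp
    · intro y; simp
  | succ n ih =>
    rw [← Fintype.sum_equiv (Fin.snocEquiv fun _ : Fin (n + 2) => V)
      (fun z => (if z.2 0 = v₀ then 1 else 0) *
        ((∏ i : Fin n, p (z.2 i.castSucc) (z.2 i.succ)) * p (z.2 (Fin.last n)) z.1))]
    · rw [Fintype.sum_prod_type_right]
      refine (Finset.sum_congr rfl fun y _ => ?_).trans ih
      change ∑ a, (if y 0 = v₀ then 1 else 0) *
        ((∏ i : Fin n, p (y i.castSucc) (y i.succ)) * p (y (Fin.last n)) a) = _
      rw [← Finset.mul_sum, ← Finset.mul_sum, hp, mul_one]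
    · rintro ⟨a, y⟩
      have e1 : ∀ i : Fin (n + 1), (Fin.snoc y a : Fin (n + 2) → V) i.castSucc = y i :=
        fun i => Fin.snoc_castSucc (α := fun _ => V) a y i
      have e2 : (Fin.snoc y a : Fin (n + 2) → V) (Fin.last (n + 1)) = a :=
        Fin.snoc_last (α := fun _ => V) a y
      change _ = (if (Fin.snoc y a : Fin (n + 2) → V) 0 = v₀ then 1 else 0) *
        ∏ i : Fin (n + 1), p ((Fin.snoc y a : Fin (n + 2) → V) i.castSucc)
          ((Fin.snoc y a : Fin (n + 2) → V) i.succ)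
      rw [Fin.prod_univ_castSucc]
      simp only [e1, Fin.succ_last, Fin.succ_castSucc, e2]
      have e3 : (Fin.snoc y a : Fin (n + 2) → V) 0 = y 0 := e1 0
      simp only [e3]

end PathSums

section Escape

variable {V : Type*} [Fintype V] [DecidableEq V] (N : Network V)

/-- The total conductance from `x` to the other vertices. -/
noncomputable def Network.escape (x : V) : ℝ := N.exitRate x * N.total x

variable {N}

lemma Network.escape_eq (hpos : ∀ w, 0 < N.total w) (x : V) :
    N.escape x = ∑ y ∈ Finset.univ.erase x, N.c x y := by
  simp only [Network.escape, Network.exitRate, Network.rate, Finset.sum_mul]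
  exact Finset.sum_congr rfl fun y _ => div_mul_cancel₀ _ (hpos x).ne'

lemma Network.exists_neighbour [Nontrivial V] (hconn : N.Connected) (x : V) :
    ∃ y, y ≠ x ∧ 0 < N.c x y := by
  obtain ⟨z, hz⟩ := exists_ne x
  by_contra! hcon
  have : ∀ w, Relation.ReflTransGen (fun a b => 0 < N.c a b) x w → w = x := by
    intro w hw
    induction hw with
    | refl => rfl
    | tail _ hbc ih =>
      by_contra hne
      rw [ih] at hbc
      exact absurd hbc (not_lt.2 (hcon _ hne))
  exact hz (this z (hconn x z))

lemma Network.escape_pos [Nontrivial V] (hconn : N.Connected) (hpos : ∀ w, 0 < N.total w) (x : V) :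
    0 < N.escape x := by
  obtain ⟨y, hy, hc⟩ := N.exists_neighbour hconn x
  rw [N.escape_eq hpos]
  exact Finset.sum_pos' (fun z _ => N.nonneg x z) ⟨y, by simp [hy], hc⟩

variable (N) in
/-- The transition probabilities of the jump chain. -/
noncomputable def Network.stepProb (x y : V) : ℝ≥0∞ := N.offDiag x y / ENNReal.ofReal (N.escape x)

lemma Network.sum_offDiag (hpos : ∀ w, 0 < N.total w) (x : V) :
    ∑ y, N.offDiag x y = ENNReal.ofReal (N.escape x) := by
  rw [N.escape_eq hpos, ENNReal.ofReal_sum_of_nonneg (fun y _ => N.nonneg x y),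
    ← Finset.add_sum_erase _ _ (Finset.mem_univ x)]
  rw [Network.offDiag, if_pos rfl, zero_add]
  refine Finset.sum_congr rfl fun y hy => ?_
  rw [Network.offDiag, if_neg (Finset.ne_of_mem_erase hy).symm]

lemma Network.sum_stepProb (hpos : ∀ w, 0 < N.total w) (hesc : ∀ w, 0 < N.escape w) (x : V) :
    ∑ y, N.stepProb x y = 1 := by
  simp only [Network.stepProb, div_eq_mul_inv]
  rw [← Finset.sum_mul, N.sum_offDiag hpos]
  exact ENNReal.mul_inv_cancel (by simpa using hesc x) ENNReal.ofReal_ne_top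

lemma Network.ofReal_rate_div (hesc : ∀ w, 0 < N.escape w) {x y : V}
    (hxy : x ≠ y) : ENNReal.ofReal (N.rate x y / N.exitRate x) = N.stepProb x y := by
  rw [Network.stepProb, Network.offDiag, if_neg hxy, ← ENNReal.ofReal_div_of_pos (hesc x),
    Network.rate, Network.escape]
  congr 1
  rw [div_div, mul_comm]

lemma Network.exitRate_nonneg (hpos : ∀ w, 0 < N.total w) (x : V) : 0 ≤ N.exitRate x :=
  Finset.sum_nonneg fun y _ => div_nonneg (N.nonneg x y) (hpos x).le

end Escape

section Law

variable {V : Type*} [Fintype V] [DecidableEq V] {N : Network V} {v₀ : V}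
  {Ω : Type*} [MeasurableSpace Ω] {μ : Measure Ω} {X : ℝ≥0 → Ω → V}

lemma Network.IsWalk.law_stepProb (hX : N.IsWalk v₀ μ X) (hpos : ∀ w, 0 < N.total w)
    (hesc : ∀ w, 0 < N.escape w) (n : ℕ) (y : ℕ → V) (r : ℕ → ℝ≥0) (h0 : y 0 = v₀)
    (hy : ∀ i < n, y i ≠ y (i + 1)) :
    μ {ω | (∀ i ≤ n, jumpTime (fun s => X s ω) i ≠ ⊤ ∧ jumpState (fun s => X s ω) i = y i) ∧
           ∀ i < n, jumpTime (fun s => X s ω) i + r i < jumpTime (fun s => X s ω) (i + 1)} =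
      ∏ i ∈ Finset.range n, (N.stepProb (y i) (y (i + 1)) *
          ENNReal.ofReal (Real.exp (-(N.exitRate (y i) * r i)))) := by
  refine (hX.law n y r h0 hy).trans ?_
  have hnn : ∀ a b, 0 ≤ N.rate a b / N.exitRate a := fun a b =>
    div_nonneg (div_nonneg (N.nonneg a b) (hpos a).le) (N.exitRate_nonneg hpos a)
  rw [ENNReal.ofReal_prod_of_nonneg fun i _ => mul_nonneg (hnn _ _) (Real.exp_nonneg _)]
  refine Finset.prod_congr rfl fun i hi => ?_
  rw [ENNReal.ofReal_mul (hnn _ _), Network.ofReal_rate_div hesc (hy i (by simpa using hi))]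

/-- The probability that the jump chain starts with a given path. -/
noncomputable def Network.chainProb (N : Network V) (v₀ : V) {n : ℕ} (y : Fin (n + 1) → V) :
    ℝ≥0∞ :=
  (if y 0 = v₀ then 1 else 0) * ∏ i : Fin n, N.stepProb (y i.castSucc) (y i.succ)

omit [Fintype V] [DecidableEq V] in
lemma natPath_zero {n : ℕ} (y : Fin (n + 1) → V) : natPath y 0 = y 0 := natPath_val y 0

omit [Fintype V] [DecidableEq V] in
lemma prod_range_natPath {n : ℕ} (y : Fin (n + 1) → V) (f : V → V → ℝ≥0∞) :
    ∏ i ∈ Finset.range n, f (natPath y i) (natPath y (i + 1))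
      = ∏ i : Fin n, f (y i.castSucc) (y i.succ) := by
  rw [Finset.prod_range]
  refine Finset.prod_congr rfl fun i _ => ?_
  rw [← natPath_val y i.castSucc, ← natPath_val y i.succ]
  simp

lemma chainProb_eq_zero_or {n : ℕ} (y : Fin (n + 1) → V) : N.chainProb v₀ y = 0 ∨
    (natPath y 0 = v₀ ∧ (∀ i < n, natPath y i ≠ natPath y (i + 1)) ∧
      N.chainProb v₀ y = ∏ i ∈ Finset.range n, N.stepProb (natPath y i) (natPath y (i + 1))) := by
  by_cases h0 : natPath y 0 = v₀
  · by_cases h : ∀ i < n, natPath y i ≠ natPath y (i + 1)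
    · refine Or.inr ⟨h0, h, ?_⟩
      rw [Network.chainProb, prod_range_natPath, if_pos (by rwa [← natPath_zero y]), one_mul]
    · push Not at h
      obtain ⟨i, hi, h⟩ := h
      left
      rw [Network.chainProb, ← prod_range_natPath y N.stepProb,
        Finset.prod_eq_zero (Finset.mem_range.2 hi), mul_zero]
      simp [Network.stepProb, Network.offDiag, h]
  · left
    rw [Network.chainProb, if_neg (by rwa [← natPath_zero y]), zero_mul]

lemma Network.sum_chainProb (hpos : ∀ w, 0 < N.total w) (hesc : ∀ w, 0 < N.escape w) (n : ℕ) :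
    ∑ y : Fin (n + 1) → V, N.chainProb v₀ y = 1 :=
  sum_prod_stochastic (N.sum_stepProb hpos hesc) v₀ n

variable [IsProbabilityMeasure μ]

/-- With zero thresholds the law gives each admissible initial path its chain probability together
with finiteness of the jump times. The events are disjoint and these probabilities sum to one. -/
lemma Network.IsWalk.ae_jumpTime_ne_top (hX : N.IsWalk v₀ μ X)
    (hr : ∀ ω s, ∀ᶠ r in 𝓝[>] s, X r ω = X s ω) (hpos : ∀ w, 0 < N.total w)
    (hesc : ∀ w, 0 < N.escape w) : ∀ᵐ ω ∂μ, ∀ k, jumpTime (fun s => X s ω) k ≠ ⊤ := by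
  rw [ae_all_iff]
  intro n
  have hmt := measurable_jumpTime hX.measurable hr
  have hms := measurableSet_jumpState hX.measurable hr
  let E : (Fin (n + 1) → V) → Set Ω := fun y =>
    {ω | ∀ i ≤ n, jumpTime (fun s => X s ω) i ≠ ⊤ ∧ jumpState (fun s => X s ω) i = natPath y i}
  have hEm : ∀ y, MeasurableSet (E y) := by
    intro y
    simp only [E, Set.ofPred_forall]
    refine MeasurableSet.iInter fun i => MeasurableSet.iInter fun _ => ?_
    exact ((hmt i) (measurableSet_singleton ⊤).compl).inter (hms i _)
  have hE : ∀ y, N.chainProb v₀ y ≤ μ (E y) := by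
    intro y
    rcases chainProb_eq_zero_or (N := N) (v₀ := v₀) y with h | ⟨h0, h, he⟩
    · rw [h]; exact zero_le
    · rw [he]
      refine le_of_eq ?_
      have := hX.law_stepProb hpos hesc n (natPath y) 0 h0 h
      simp only [Pi.zero_apply, NNReal.coe_zero, mul_zero, neg_zero, Real.exp_zero,
        ENNReal.ofReal_one, mul_one, ENNReal.coe_zero, add_zero] at this
      rw [← this]
      congr 1
      ext ω
      simp only [E, Set.mem_ofPred_eq]
      exact ⟨fun h => h.1, fun h => ⟨h, fun i hi => jumpTime_lt_succ (hr ω) (h i hi.le).1⟩⟩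
  have hdisj : Pairwise (Function.onFun Disjoint E) := by
    intro y y' hne
    refine Set.disjoint_left.2 fun ω h h' => hne ?_
    funext i
    rw [← natPath_val y i, ← natPath_val y' i]
    exact ((h i (by omega)).2).symm.trans (h' i (by omega)).2
  have hone : 1 ≤ μ (⋃ y, E y) := by
    rw [measure_iUnion hdisj hEm, tsum_fintype, ← N.sum_chainProb (v₀ := v₀) hpos hesc n]
    exact Finset.sum_le_sum fun y _ => hE y
  have hae : ∀ᵐ ω ∂μ, ω ∈ ⋃ y, E y :=
    (prob_compl_eq_zero_iff (MeasurableSet.iUnion hEm)).2 (le_antisymm prob_le_one hone)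
  filter_upwards [hae] with ω hω
  obtain ⟨y, hy⟩ := Set.mem_iUnion.1 hω
  exact (hy n le_rfl).1

lemma Network.IsWalk.ae_jumpState_zero (hX : N.IsWalk v₀ μ X) :
    ∀ᵐ ω ∂μ, jumpState (fun s => X s ω) 0 = v₀ := by
  have h := hX.law 0 (fun _ => v₀) 0 rfl (by simp)
  simp only [Nat.le_zero, forall_eq, jumpTime] at h
  have hm : MeasurableSet {ω | X 0 ω = v₀} := hX.measurable 0 v₀
  have : μ {ω | X 0 ω = v₀} = 1 := by simpa using h
  have h2 := (prob_compl_eq_zero_iff hm).2 this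
  exact (show ∀ᵐ ω ∂μ, X 0 ω = v₀ from h2)

/-- The joint law of the jump chain and the local times accumulated in the successive stays. -/
lemma Network.IsWalk.law_holding (hX : N.IsWalk v₀ μ X)
    (hr : ∀ ω s, ∀ᶠ r in 𝓝[>] s, X r ω = X s ω) (hpos : ∀ w, 0 < N.total w)
    (hesc : ∀ w, 0 < N.escape w) (n : ℕ) (y : ℕ → V) (r : ℕ → ℝ) (h0 : y 0 = v₀)
    (hy : ∀ i < n, y i ≠ y (i + 1)) :
    μ {ω | (∀ i ≤ n, jumpState (fun s => X s ω) i = y i) ∧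
           ∀ i < n, r i < N.holding (fun s => X s ω) i} =
      ∏ i ∈ Finset.range n, (N.stepProb (y i) (y (i + 1)) *
          ENNReal.ofReal (Real.exp (-(N.escape (y i) * max (r i) 0)))) := by
  -- Multiplication by the total conductance turns local time into real time. Stays are positive, so
  -- a negative threshold acts as zero; allowing all real thresholds makes the half-lines a
  -- generating class on `ℝ`.
  have hlaw := hX.law_stepProb hpos hesc n y (fun i => (N.total (y i) * max (r i) 0).toNNReal) h0 hy
  have hnn : ∀ i, 0 ≤ N.total (y i) * max (r i) 0 := fun i =>
    mul_nonneg (hpos _).le (le_max_right _ _)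
  have e : ∀ i, N.exitRate (y i) * (N.total (y i) * max (r i) 0).toNNReal
      = N.escape (y i) * max (r i) 0 := by
    intro i
    rw [Real.coe_toNNReal _ (hnn i), Network.escape, mul_assoc]
  simp only [e] at hlaw
  rw [← hlaw]
  refine measure_congr ?_
  filter_upwards [hX.ae_jumpTime_ne_top hr hpos hesc] with ω hω
  refine propext ?_
  change ((∀ i ≤ n, jumpState (fun s => X s ω) i = y i) ∧
           ∀ i < n, r i < N.holding (fun s => X s ω) i) ↔
    ((∀ i ≤ n, jumpTime (fun s => X s ω) i ≠ ⊤ ∧ jumpState (fun s => X s ω) i = y i) ∧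
           ∀ i < n, jumpTime (fun s => X s ω) i + (N.total (y i) * max (r i) 0).toNNReal
            < jumpTime (fun s => X s ω) (i + 1))
  have h1 : (∀ i ≤ n, jumpTime (fun s => X s ω) i ≠ ⊤ ∧ jumpState (fun s => X s ω) i = y i) ↔
      (∀ i ≤ n, jumpState (fun s => X s ω) i = y i) :=
    ⟨fun h i hi => (h i hi).2, fun h i hi => ⟨hω i, h i hi⟩⟩
  rw [h1]
  refine and_congr_right fun h => forall₂_congr fun i hi => ?_
  set τ := (jumpTime (fun s => X s ω) i) with hτ
  set τ' := (jumpTime (fun s => X s ω) (i + 1)) with hτ'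
  have hlt : τ.toReal < τ'.toReal :=
    (ENNReal.toReal_lt_toReal (hω i) (hω (i + 1))).2 (jumpTime_lt_succ (hr ω) (hω i))
  rw [Network.holding, h i hi.le, lt_div_iff₀ (hpos _),
    ← ENNReal.toReal_lt_toReal (ENNReal.add_ne_top.2 ⟨hω i, ENNReal.coe_ne_top⟩) (hω (i + 1)),
    ENNReal.toReal_add (hω i) ENNReal.coe_ne_top, ENNReal.coe_toReal, Real.coe_toNNReal _ (hnn i)]
  have hc := hpos (y i)
  rcases le_total (r i) 0 with hneg | hnn'
  · rw [max_eq_right hneg]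
    constructor
    · intro _; linarith
    · intro _; nlinarith
  · rw [max_eq_left hnn']
    constructor
    · intro _; linarith
    · intro _; linarith

end Law

/-! ### Exponential stays, left unnormalised. -/

section StayLaw

/-- The measure with density `s ↦ exp (-θ s)` on the positive half-line. -/
noncomputable def stayLaw (θ : ℝ) : Measure ℝ :=
  (volume.restrict (Set.Ioi 0)).withDensity fun s => ENNReal.ofReal (Real.exp (-(θ * s)))

lemma stayLaw_Ioi {θ : ℝ} (hθ : 0 < θ) (r : ℝ) :
    stayLaw θ (Set.Ioi r) = ENNReal.ofReal (Real.exp (-(θ * max r 0))) / ENNReal.ofReal θ := by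
  rw [stayLaw, withDensity_apply _ measurableSet_Ioi, Measure.restrict_restrict measurableSet_Ioi,
    Set.Ioi_inter_Ioi, ← ofReal_integral_eq_lintegral_ofReal]
  · rw [← ENNReal.ofReal_div_of_pos hθ]
    congr 1
    have := integral_exp_mul_Ioi (a := -θ) (by linarith) (max r 0)
    simp only [neg_mul] at this
    rw [show r ⊔ 0 = max r 0 from rfl, this]
    field_simp
  · have := integrableOn_exp_mul_Ioi (a := -θ) (by linarith) (max r 0)
    exact (integrableOn_congr_fun (fun s _ => by simp) measurableSet_Ioi).1 this
  · exact Eventually.of_forall fun s => Real.exp_nonneg _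

lemma stayLaw_univ {θ : ℝ} (hθ : 0 < θ) : stayLaw θ Set.univ = (ENNReal.ofReal θ)⁻¹ := by
  have h : stayLaw θ (Set.Iic 0) = 0 := by
    rw [stayLaw, withDensity_apply _ measurableSet_Iic, Measure.restrict_restrict measurableSet_Iic,
      Set.Iic_inter_Ioi, Set.Ioc_self, Measure.restrict_empty, lintegral_zero_measure]
  rw [← Set.Iic_union_Ioi (a := (0 : ℝ)),
    measure_union (Set.Iic_disjoint_Ioi le_rfl) measurableSet_Ioi, h, stayLaw_Ioi hθ]
  simp

lemma isFiniteMeasure_stayLaw {θ : ℝ} (hθ : 0 < θ) : IsFiniteMeasure (stayLaw θ) :=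
  ⟨by rw [stayLaw_univ hθ]; simpa using hθ⟩

end StayLaw

/-! ### Product measures: integrals of products, scalings and densities. -/

section PiMeasures

lemma lintegral_fin_prod_eq_prod {n : ℕ} {E : Fin n → Type*} {mE : ∀ i, MeasurableSpace (E i)}
    {μ : (i : Fin n) → Measure (E i)} [∀ i, SigmaFinite (μ i)] {f : (i : Fin n) → E i → ℝ≥0∞}
    (hf : ∀ i, Measurable (f i)) :
    ∫⁻ x : (i : Fin n) → E i, ∏ i, f i (x i) ∂(Measure.pi μ) = ∏ i, ∫⁻ x, f i x ∂(μ i) := by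
  induction n with
  | zero => simp
  | succ n ih =>
    have hm : Measurable fun x : (i : Fin n) → E i.succ => ∏ i, f i.succ (x i) :=
      Finset.measurable_prod _ fun i _ => (hf i.succ).comp (measurable_pi_apply i)
    calc
      _ = ∫⁻ x : E 0 × ((i : Fin n) → E (Fin.succ i)),
            f 0 x.1 * ∏ i : Fin n, f (Fin.succ i) (x.2 i)
            ∂((μ 0).prod (Measure.pi (fun i ↦ μ i.succ))) := by
          rw [← ((measurePreserving_piFinSuccAbove μ 0).symm).lintegral_comp_emb
            (MeasurableEquiv.measurableEmbedding _)]
          refine lintegral_congr fun x => ?_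
          rw [Fin.prod_univ_succ]
          rfl
      _ = (∫⁻ x, f 0 x ∂μ 0)
            * ∏ i : Fin n, ∫⁻ (x : E (Fin.succ i)), f (Fin.succ i) x ∂(μ i.succ) := by
          rw [← ih fun i => hf i.succ, ← lintegral_prod_mul (hf 0).aemeasurable hm.aemeasurable]
      _ = ∏ i, ∫⁻ x, f i x ∂(μ i) := by rw [Fin.prod_univ_succ]

lemma lintegral_pi_prod_eq_prod {ι : Type*} [Fintype ι] {E : ι → Type*}
    {mE : ∀ i, MeasurableSpace (E i)}
    {μ : (i : ι) → Measure (E i)} [∀ i, SigmaFinite (μ i)] {f : (i : ι) → E i → ℝ≥0∞}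
    (hf : ∀ i, Measurable (f i)) :
    ∫⁻ x : (i : ι) → E i, ∏ i, f i (x i) ∂(Measure.pi μ) = ∏ i, ∫⁻ x, f i x ∂(μ i) := by
  let e := (Fintype.equivFin ι).symm
  rw [← (measurePreserving_piCongrLeft μ e).lintegral_comp_emb
    (MeasurableEquiv.measurableEmbedding _)]
  simp_rw [← e.prod_comp, MeasurableEquiv.coe_piCongrLeft, Equiv.piCongrLeft_apply_apply]
  exact lintegral_fin_prod_eq_prod fun i => hf (e i)

variable {ι : Type*} [Fintype ι]

lemma pi_smul_measure {ν : ι → Measure ℝ} [∀ i, IsFiniteMeasure (ν i)] {k : ι → ℝ≥0∞}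
    (hk : ∀ i, k i ≠ ⊤) :
    Measure.pi (fun i => k i • ν i) = (∏ i, k i) • Measure.pi ν := by
  have : ∀ i, IsFiniteMeasure (k i • ν i) := fun i => Measure.smul_finite _ (hk i)
  refine Measure.pi_eq fun s _ => ?_
  simp [Finset.prod_mul_distrib]

lemma pi_withDensity_prod {lam : ι → Measure ℝ} [∀ i, SigmaFinite (lam i)] {g : ι → ℝ → ℝ≥0∞}
    (hg : ∀ i, Measurable (g i)) (hg' : ∀ i x, g i x ≠ ⊤) :
    Measure.pi (fun i => (lam i).withDensity (g i))
      = (Measure.pi lam).withDensity fun x => ∏ i, g i (x i) := by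
  have : ∀ i, SigmaFinite ((lam i).withDensity (g i)) := fun i =>
    SigmaFinite.withDensity_of_ne_top (Eventually.of_forall (hg' i))
  refine Measure.pi_eq fun s hs => ?_
  rw [withDensity_apply _ (MeasurableSet.univ_pi hs), ← lintegral_indicator (MeasurableSet.univ_pi hs)]
  have h1 : ∀ x : ι → ℝ, (Set.univ.pi s).indicator (fun x => ∏ i, g i (x i)) x
      = ∏ i, (s i).indicator (g i) (x i) := by
    intro x
    by_cases hx : x ∈ Set.univ.pi s
    · rw [Set.indicator_of_mem hx]
      exact Finset.prod_congr rfl fun i _ => (Set.indicator_of_mem (hx i trivial) _).symm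
    · rw [Set.indicator_of_notMem hx]
      simp only [Set.mem_pi, Set.mem_univ, true_imp_iff, not_forall] at hx
      obtain ⟨i, hi⟩ := hx
      exact (Finset.prod_eq_zero (Finset.mem_univ i) (Set.indicator_of_notMem hi _)).symm
  simp_rw [h1]
  rw [lintegral_pi_prod_eq_prod fun i => (hg i).indicator (hs i)]
  refine Finset.prod_congr rfl fun i _ => ?_
  rw [withDensity_apply _ (hs i), lintegral_indicator (hs i)]

end PiMeasures

/-! ### Total stay at each vertex, as independent convolution powers. -/

section BlockSums

/-- Convolution powers of a measure. -/
noncomputable def convPow (ν : Measure ℝ) : ℕ → Measure ℝ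
  | 0 => Measure.dirac 0
  | k + 1 => ν.conv (convPow ν k)

lemma isFiniteMeasure_convPow (ν : Measure ℝ) [IsFiniteMeasure ν] (k : ℕ) :
    IsFiniteMeasure (convPow ν k) := by
  induction k with
  | zero => rw [convPow]; infer_instance
  | succ k ih => rw [convPow]; infer_instance

variable {V : Type*} [Fintype V] [DecidableEq V]

/-- The sums of the coordinates over the blocks with a given label. -/
def blockSum {n : ℕ} (y : Fin n → V) (T : Fin n → ℝ) (w : V) : ℝ :=
  ∑ i, if y i = w then T i else 0

omit [Fintype V] in
lemma measurable_blockSum {n : ℕ} (y : Fin n → V) : Measurable (blockSum y) := by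
  refine measurable_pi_lambda _ fun w => Finset.measurable_sum _ fun i _ => ?_
  split_ifs
  · exact measurable_pi_apply i
  · exact measurable_const

/-- Distinct vertices use disjoint sets of coordinates, so their totals are independent. In the
induction the first coordinate adds one convolution factor at the vertex `y 0` and leaves the others
unchanged. -/
lemma map_blockSum (ν : V → Measure ℝ) [∀ w, IsFiniteMeasure (ν w)] {n : ℕ} (y : Fin n → V) :
    (Measure.pi fun i => ν (y i)).map (blockSum y)
      = Measure.pi fun w => convPow (ν w) ((List.ofFn y).count w) := by
  have hfin : ∀ w k, IsFiniteMeasure (convPow (ν w) k) := fun w k => isFiniteMeasure_convPow _ k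
  induction n with
  | zero =>
    refine (Measure.pi_eq fun s hs => ?_).symm
    rw [Measure.map_apply (measurable_blockSum y) (MeasurableSet.univ_pi hs)]
    simp only [List.ofFn_zero, List.count_nil, convPow]
    rw [Measure.pi_of_empty (fun i => ν (y i)) (fun i => i.elim0), Measure.dirac_apply' _ (measurable_blockSum y (MeasurableSet.univ_pi hs))]
    simp_rw [Measure.dirac_apply' _ (hs _)]
    by_cases h : ∀ w, (0 : ℝ) ∈ s w
    · rw [Set.indicator_of_mem]
      · simp [h]
      · intro w _
        simpa [blockSum] using h w
    · rw [Set.indicator_of_notMem]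
      · obtain ⟨w, hw⟩ := not_forall.1 h
        exact (Finset.prod_eq_zero (Finset.mem_univ w) (Set.indicator_of_notMem hw _)).symm
      · intro hmem
        exact h fun w => by simpa [blockSum] using hmem w trivial
  | succ n ih =>
    specialize ih fun i => y i.succ
    let add : ℝ × (V → ℝ) → V → ℝ := fun z w => (if y 0 = w then z.1 else 0) + z.2 w
    have hadd : Measurable add := by
      refine measurable_pi_lambda _ fun w => Measurable.add ?_ ?_
      · split_ifs
        · exact measurable_fst
        · exact measurable_const
      · exact (measurable_pi_apply w).comp measurable_snd
    have hstep : (Measure.pi fun i => ν (y i)).map (blockSum y) =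
        ((ν (y 0)).prod (Measure.pi fun w =>
          convPow (ν w) ((List.ofFn fun i => y i.succ).count w))).map add := by
      rw [← ih]
      conv_rhs => rw [← Measure.map_id (μ := ν (y 0)),
        Measure.map_prod_map _ _ measurable_id (measurable_blockSum _),
        Measure.map_map hadd (measurable_id.prodMap (measurable_blockSum _))]
      rw [← ((measurePreserving_piFinSuccAbove (fun i => ν (y i)) 0).symm).map_eq,
        Measure.map_map (measurable_blockSum _) (MeasurableEquiv.measurable _)]
      congr 1
      funext z
      funext w
      simp only [Function.comp, blockSum, add, Fin.sum_univ_succ]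
      rfl
    rw [hstep]
    refine (Measure.pi_eq fun s hs => ?_).symm
    rw [Measure.map_apply hadd (MeasurableSet.univ_pi hs),
      Measure.prod_apply (hadd (MeasurableSet.univ_pi hs))]
    have hpre : ∀ a : ℝ, Prod.mk a ⁻¹' (add ⁻¹' Set.univ.pi s) =
        Set.univ.pi fun w => (fun b => (if y 0 = w then a else 0) + b) ⁻¹' s w := by
      intro a; ext S; simp [add]
    simp_rw [hpre, Measure.pi_pi]
    rw [← Finset.mul_prod_erase _ _ (Finset.mem_univ (y 0))]
    have hrest : ∀ a : ℝ, ∏ w, convPow (ν w) ((List.ofFn fun i => y i.succ).count w)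
          ((fun b => (if y 0 = w then a else 0) + b) ⁻¹' s w)
        = convPow (ν (y 0)) ((List.ofFn fun i => y i.succ).count (y 0)) ((fun b => a + b) ⁻¹' s (y 0))
          * ∏ w ∈ Finset.univ.erase (y 0), convPow (ν w) ((List.ofFn y).count w) (s w) := by
      intro a
      rw [← Finset.mul_prod_erase _ _ (Finset.mem_univ (y 0))]
      congr 1
      · simp
      · refine Finset.prod_congr rfl fun w hw => ?_
        have hne : y 0 ≠ w := (Finset.ne_of_mem_erase hw).symm
        rw [List.ofFn_succ, List.count_cons_of_ne hne]
        simp [hne]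
    simp_rw [hrest]
    rw [lintegral_mul_const' _ _
      (ENNReal.prod_ne_top fun w _ => measure_ne_top _ _)]
    congr 1
    rw [List.ofFn_succ, List.count_cons_self, convPow, Measure.conv,
      Measure.map_apply measurable_add (hs _), Measure.prod_apply (measurable_add (hs _))]
    rfl

end BlockSums

/-! ### Gamma densities for the accumulated local times. -/

section GammaDensity

lemma lintegral_pow_div_factorial {x : ℝ} (hx : 0 ≤ x) (k : ℕ) :
    ∫⁻ b in Set.Ioc 0 x, ENNReal.ofReal (b ^ k / k.factorial)
      = ENNReal.ofReal (x ^ (k + 1) / (k + 1).factorial) := by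
  rw [← ofReal_integral_eq_lintegral_ofReal]
  · congr 1
    rw [← intervalIntegral.integral_of_le hx, intervalIntegral.integral_div, integral_pow,
      Nat.factorial_succ]
    push_cast
    field_simp
    simp
  · exact ((continuous_pow k).div_const _).integrableOn_Ioc
  · filter_upwards [ae_restrict_mem measurableSet_Ioc] with b hb
    have := hb.1.le
    positivity

/-- The density of the local time at a vertex with escape rate `θ` after `n` visits. -/
noncomputable def localTimeDensity (θ : ℝ) (n : ℕ) (x : ℝ) : ℝ≥0∞ :=
  ENNReal.ofReal (Real.exp (-(θ * x))) * visitWeight x n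

lemma measurable_localTimeDensity (θ : ℝ) (n : ℕ) : Measurable (localTimeDensity θ n) := by
  unfold localTimeDensity visitWeight
  fun_prop

lemma localTimeDensity_ne_top (θ : ℝ) (n : ℕ) (x : ℝ) : localTimeDensity θ n x ≠ ⊤ :=
  ENNReal.mul_ne_top ENNReal.ofReal_ne_top ENNReal.ofReal_ne_top

/-- In the convolution the exponentials merge into `exp (-θ x)`, and what remains is the integral of
`b ^ k / k!` over `(0, x)`. -/
lemma convPow_stayLaw {θ : ℝ} (hθ : 0 < θ) (k : ℕ) :
    convPow (stayLaw θ) (k + 1)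
      = (volume.restrict (Set.Ioi 0)).withDensity (localTimeDensity θ (k + 1)) := by
  have hfin := isFiniteMeasure_stayLaw hθ
  have hgm : ∀ n, Measurable (localTimeDensity θ n) := measurable_localTimeDensity θ
  have hem : Measurable fun s : ℝ => ENNReal.ofReal (Real.exp (-(θ * s))) := by fun_prop
  induction k with
  | zero =>
    rw [convPow, convPow, Measure.conv_dirac_zero, stayLaw]
    congr 1
    funext s
    simp [localTimeDensity, visitWeight]
  | succ k ih =>
    have := isFiniteMeasure_convPow (stayLaw θ) (k + 1)
    rw [convPow, Measure.conv_comm, ih]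
    have : SFinite (stayLaw θ) := inferInstance
    refine Measure.ext_of_lintegral _ fun f hf => ?_
    rw [Measure.lintegral_conv hf, lintegral_withDensity_eq_lintegral_mul _ (hgm _) (by fun_prop),
      lintegral_withDensity_eq_lintegral_mul _ (hgm _) hf]
    have h1 : ∀ b, ∫⁻ a, f (b + a) ∂(stayLaw θ) = ∫⁻ x, (Set.Ioi b).indicator
        (fun x => ENNReal.ofReal (Real.exp (-(θ * (x - b)))) * f x) x := by
      intro b
      rw [stayLaw, lintegral_withDensity_eq_lintegral_mul _ hem (by fun_prop),
        ← lintegral_indicator measurableSet_Ioi, ← lintegral_add_left_eq_self ((Set.Ioi b).indicator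
          fun x => ENNReal.ofReal (Real.exp (-(θ * (x - b)))) * f x) b]
      refine lintegral_congr fun a => ?_
      by_cases ha : 0 < a
      · rw [Set.indicator_of_mem (show a ∈ Set.Ioi 0 from ha),
          Set.indicator_of_mem (show b + a ∈ Set.Ioi b by simpa using ha)]
        simp
      · rw [Set.indicator_of_notMem (show a ∉ Set.Ioi 0 from ha),
          Set.indicator_of_notMem (show b + a ∉ Set.Ioi b by simpa using ha)]
    simp only [Pi.mul_apply, h1]
    simp_rw [← lintegral_const_mul' _ _ (localTimeDensity_ne_top θ (k + 1) _)]
    rw [lintegral_lintegral_swap]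
    · rw [← lintegral_indicator measurableSet_Ioi]
      refine lintegral_congr fun x => ?_
      have h2 : ∀ᵐ b ∂(volume.restrict (Set.Ioi (0 : ℝ))),
          localTimeDensity θ (k + 1) b * (Set.Ioi b).indicator
            (fun x => ENNReal.ofReal (Real.exp (-(θ * (x - b)))) * f x) x
          = (ENNReal.ofReal (Real.exp (-(θ * x))) * f x) *
            (Set.Iio x).indicator (fun b => ENNReal.ofReal (b ^ k / k.factorial)) b := by
        refine Eventually.of_forall fun b => ?_
        by_cases hb : b < x
        · rw [Set.indicator_of_mem (show x ∈ Set.Ioi b from hb),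
            Set.indicator_of_mem (show b ∈ Set.Iio x from hb), localTimeDensity, visitWeight,
            Nat.add_sub_cancel]
          have : ENNReal.ofReal (Real.exp (-(θ * x))) = ENNReal.ofReal (Real.exp (-(θ * b))) *
              ENNReal.ofReal (Real.exp (-(θ * (x - b)))) := by
            rw [← ENNReal.ofReal_mul (Real.exp_nonneg _), ← Real.exp_add]
            congr 2; ring
          rw [this]; ring
        · rw [Set.indicator_of_notMem (show x ∉ Set.Ioi b from hb),
            Set.indicator_of_notMem (show b ∉ Set.Iio x from hb), mul_zero, mul_zero]
      rw [lintegral_congr_ae h2, lintegral_const_mul _ ((by fun_prop : Measurable fun b : ℝ =>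
        ENNReal.ofReal (b ^ k / k.factorial)).indicator measurableSet_Iio),
        lintegral_indicator measurableSet_Iio, Measure.restrict_restrict measurableSet_Iio,
        Set.inter_comm, Set.Ioi_inter_Iio]
      by_cases hx : 0 < x
      · rw [Set.indicator_of_mem (show x ∈ Set.Ioi 0 from hx),
          restrict_Ioo_eq_restrict_Ioc, lintegral_pow_div_factorial hx.le]
        simp only [localTimeDensity, visitWeight, Nat.add_sub_cancel]
        ring
      · rw [Set.indicator_of_notMem (show x ∉ Set.Ioi 0 from hx), Set.Ioo_eq_empty hx]
        simp
    · refine Measurable.aemeasurable ?_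
      refine ((hgm (k + 1)).comp measurable_fst).mul ?_
      have : Measurable fun z : ℝ × ℝ => {z : ℝ × ℝ | z.1 < z.2}.indicator
          (fun z => ENNReal.ofReal (Real.exp (-(θ * (z.2 - z.1)))) * f z.2) z :=
        Measurable.indicator (by fun_prop) (measurableSet_lt measurable_fst measurable_snd)
      exact this

/-- The probability that exactly `k` exponential stays fit into the local time `a`. -/
lemma lintegral_convPow_stayLaw {θ a : ℝ} (hθ : 0 < θ) (ha : 0 ≤ a) (k : ℕ) :
    ∫⁻ x, (Set.Iic a).indicator (fun x => ENNReal.ofReal (Real.exp (-(θ * (a - x))))) x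
      ∂(convPow (stayLaw θ) k) = localTimeDensity θ (k + 1) a := by
  cases k with
  | zero =>
    rw [convPow, lintegral_dirac' _ ((by fun_prop : Measurable fun x : ℝ =>
      ENNReal.ofReal (Real.exp (-(θ * (a - x))))).indicator measurableSet_Iic),
      Set.indicator_of_mem (show (0 : ℝ) ∈ Set.Iic a from ha)]
    simp [localTimeDensity, visitWeight]
  | succ k =>
    have hm : Measurable ((Set.Iic a).indicator
        (fun x => ENNReal.ofReal (Real.exp (-(θ * (a - x)))))) :=
      (by fun_prop : Measurable fun x : ℝ =>
        ENNReal.ofReal (Real.exp (-(θ * (a - x))))).indicator measurableSet_Iic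
    rw [convPow_stayLaw hθ, lintegral_withDensity_eq_lintegral_mul _
      (measurable_localTimeDensity θ _) hm]
    have h2 : ∀ b, (localTimeDensity θ (k + 1) * (Set.Iic a).indicator
        (fun x => ENNReal.ofReal (Real.exp (-(θ * (a - x)))))) b
        = ENNReal.ofReal (Real.exp (-(θ * a))) *
          (Set.Iic a).indicator (fun b => ENNReal.ofReal (b ^ k / k.factorial)) b := by
      intro b
      rw [Pi.mul_apply]
      by_cases hb : b ≤ a
      · rw [Set.indicator_of_mem (show b ∈ Set.Iic a from hb),
          Set.indicator_of_mem (show b ∈ Set.Iic a from hb), localTimeDensity, visitWeight,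
          Nat.add_sub_cancel]
        have : ENNReal.ofReal (Real.exp (-(θ * a))) = ENNReal.ofReal (Real.exp (-(θ * b))) *
            ENNReal.ofReal (Real.exp (-(θ * (a - b)))) := by
          rw [← ENNReal.ofReal_mul (Real.exp_nonneg _), ← Real.exp_add]
          congr 2; ring
        rw [this]; ring
      · rw [Set.indicator_of_notMem (show b ∉ Set.Iic a from hb),
          Set.indicator_of_notMem (show b ∉ Set.Iic a from hb), mul_zero, mul_zero]
    simp_rw [h2]
    rw [lintegral_const_mul _ ((by fun_prop : Measurable fun b : ℝ =>
        ENNReal.ofReal (b ^ k / k.factorial)).indicator measurableSet_Iic),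
      lintegral_indicator measurableSet_Iic, Measure.restrict_restrict measurableSet_Iic,
      Set.inter_comm, Set.Ioi_inter_Iic, lintegral_pow_div_factorial ha]
    simp only [localTimeDensity, visitWeight, Nat.add_sub_cancel]

end GammaDensity

/-! ### The reference measure and the density contributed by the stays. -/

section ReferenceMeasure

variable {V : Type*} [Fintype V] [DecidableEq V]

/-- Lebesgue measure on the positive half-line in each coordinate except `v₀`, where all the mass
sits at `a`. -/
noncomputable def slotMeasure (v₀ : V) (a : ℝ) (w : V) : Measure ℝ :=
  if w = v₀ then Measure.dirac a else volume.restrict (Set.Ioi 0)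

omit [Fintype V] in
instance sigmaFinite_slotMeasure (v₀ : V) (a : ℝ) (w : V) : SigmaFinite (slotMeasure v₀ a w) := by
  unfold slotMeasure
  split_ifs <;> infer_instance

/-- The measure on vectors of local times with respect to which those at the inverse local time
`a` at `v₀` have a density. -/
noncomputable def refMeasure (v₀ : V) (a : ℝ) : Measure (V → ℝ) := Measure.pi (slotMeasure v₀ a)

/-- Here `z.2` holds the totals of the completed stays and `z.1` the stay at `v₀` that straddles
level `a`. Each vertex other than `v₀` must have a completed stay, since the zeroth convolution
power is a point mass and has no Lebesgue density. -/
lemma stayLaw_blockLaw_apply {v₀ : V} {a : ℝ} (ha : 0 ≤ a) {θ : V → ℝ} (hθ : ∀ w, 0 < θ w)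
    {k : V → ℕ} (hk : ∀ w, w ≠ v₀ → k w ≠ 0) {B : Set (V → ℝ)} (hB : MeasurableSet B) :
    ENNReal.ofReal (θ v₀) * ((stayLaw (θ v₀)).prod (Measure.pi fun w => convPow (stayLaw (θ w)) (k w)))
        {z | (z.2 v₀ ≤ a ∧ a < z.2 v₀ + z.1) ∧ Function.update z.2 v₀ a ∈ B}
      = ∫⁻ l in B, ∏ w, localTimeDensity (θ w) (k w + if w = v₀ then 1 else 0) (l w)
          ∂(refMeasure v₀ a) := by
  have hfin : ∀ w, IsFiniteMeasure (stayLaw (θ w)) := fun w => isFiniteMeasure_stayLaw (hθ w)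
  have hfin' : ∀ w, IsFiniteMeasure (convPow (stayLaw (θ w)) (k w)) :=
    fun w => isFiniteMeasure_convPow _ _
  let g : V → ℝ → ℝ≥0∞ := fun w => localTimeDensity (θ w) (k w + if w = v₀ then 1 else 0)
  have hg : ∀ w, Measurable (g w) := fun w => measurable_localTimeDensity _ _
  have hg' : ∀ w x, g w x ≠ ⊤ := fun w x => localTimeDensity_ne_top _ _ _
  have hsf : ∀ w, SigmaFinite ((slotMeasure v₀ a w).withDensity (g w)) := fun w =>
    SigmaFinite.withDensity_of_ne_top (Eventually.of_forall (hg' w))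
  set ρ := (stayLaw (θ v₀)).prod (Measure.pi fun w => convPow (stayLaw (θ w)) (k w)) with hρ
  let C : Set (ℝ × (V → ℝ)) := {z | z.2 v₀ ≤ a ∧ a < z.2 v₀ + z.1}
  let φ : ℝ × (V → ℝ) → V → ℝ := fun z => Function.update z.2 v₀ a
  have hφ : Measurable φ := by
    refine measurable_pi_lambda _ fun w => ?_
    by_cases h : w = v₀
    · subst h; simp [φ]
    · simp only [φ, Function.update_of_ne h]
      exact (measurable_pi_apply w).comp measurable_snd
  have hCm : MeasurableSet C :=
    MeasurableSet.inter
      (measurableSet_le (f := fun z : ℝ × (V → ℝ) => z.2 v₀) (g := fun _ => a) (by fun_prop)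
        measurable_const)
      (measurableSet_lt (f := fun _ => a) (g := fun z : ℝ × (V → ℝ) => z.2 v₀ + z.1)
        measurable_const (by fun_prop))
  have key : Measure.pi (fun w => (slotMeasure v₀ a w).withDensity (g w))
      = ENNReal.ofReal (θ v₀) • (ρ.restrict C).map φ := by
    refine Measure.pi_eq fun s hs => ?_
    have hsm := MeasurableSet.univ_pi hs
    rw [Measure.smul_apply, smul_eq_mul, Measure.map_apply hφ hsm, Measure.restrict_apply (hφ hsm),
      hρ, Measure.prod_apply_symm ((hφ hsm).inter hCm)]
    let f : V → ℝ → ℝ≥0∞ := fun w => if w = v₀ then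
        (fun x => (s v₀).indicator 1 a *
          (Set.Iic a).indicator (fun x => ENNReal.ofReal (Real.exp (-(θ v₀ * (a - x))))) x)
      else (s w).indicator 1
    have hf : ∀ w, Measurable (f w) := by
      intro w
      by_cases h : w = v₀
      · simp only [f, h, if_true]
        refine Measurable.const_mul ?_ _
        exact (by fun_prop : Measurable fun x : ℝ =>
          ENNReal.ofReal (Real.exp (-(θ v₀ * (a - x))))).indicator measurableSet_Iic
      · simp only [f, h, if_false]
        exact measurable_one.indicator (hs w)
    -- Integrating out the straddling stay leaves the probability `exp (-θ (a - S v₀))` of surviving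
    -- the remaining local time; the prefactor normalises `stayLaw`.
    have hslice : ∀ S : V → ℝ, ENNReal.ofReal (θ v₀) *
        stayLaw (θ v₀) ((fun x => (x, S)) ⁻¹' (φ ⁻¹' Set.univ.pi s ∩ C)) = ∏ w, f w (S w) := by
      intro S
      rw [← Finset.mul_prod_erase _ _ (Finset.mem_univ v₀)]
      have hfr : ∀ w ∈ Finset.univ.erase v₀, f w (S w) = (s w).indicator 1 (S w) := by
        intro w hw
        simp only [f, Finset.ne_of_mem_erase hw, if_false]
      rw [Finset.prod_congr rfl hfr]
      have hf0 : f v₀ (S v₀) = (s v₀).indicator 1 a * (Set.Iic a).indicator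
          (fun x => ENNReal.ofReal (Real.exp (-(θ v₀ * (a - x))))) (S v₀) := by
        simp only [f, if_true]
      rw [hf0]
      by_cases h1 : a ∈ s v₀ ∧ S v₀ ≤ a ∧ ∀ w ∈ Finset.univ.erase v₀, S w ∈ s w
      · obtain ⟨h1, h2, h3⟩ := h1
        have hset : (fun x => (x, S)) ⁻¹' (φ ⁻¹' Set.univ.pi s ∩ C) = Set.Ioi (a - S v₀) := by
          ext x
          simp only [Set.mem_preimage, Set.mem_inter_iff, Set.mem_univ_pi, φ, C, Set.mem_ofPred_eq,
            Set.mem_Ioi]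
          constructor
          · rintro ⟨-, -, h⟩; linarith
          · intro h
            refine ⟨fun w => ?_, h2, by linarith⟩
            by_cases hw : w = v₀
            · subst hw; simpa using h1
            · rw [Function.update_of_ne hw]
              exact h3 w (by simp [hw])
        rw [hset, stayLaw_Ioi (hθ v₀), Set.indicator_of_mem h1,
          Set.indicator_of_mem (show S v₀ ∈ Set.Iic a from h2),
          Finset.prod_eq_one fun w hw => Set.indicator_of_mem (h3 w hw) _, max_eq_left (by linarith),
          Pi.one_apply, one_mul, mul_one]
        exact ENNReal.mul_div_cancel (by simpa using hθ v₀) ENNReal.ofReal_ne_top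
      · have hset : (fun x => (x, S)) ⁻¹' (φ ⁻¹' Set.univ.pi s ∩ C) = ∅ := by
          refine Set.eq_empty_of_forall_notMem fun x hx => h1 ?_
          simp only [Set.mem_preimage, Set.mem_inter_iff, Set.mem_univ_pi, φ, C,
            Set.mem_ofPred_eq] at hx
          refine ⟨by simpa using hx.1 v₀, hx.2.1, fun w hw => ?_⟩
          have := hx.1 w
          rwa [Function.update_of_ne (Finset.ne_of_mem_erase hw)] at this
        rw [hset, measure_empty, mul_zero]
        symm
        by_cases h2 : a ∈ s v₀
        · by_cases h3 : S v₀ ≤ a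
          · have : ∃ w ∈ Finset.univ.erase v₀, S w ∉ s w := by
              by_contra! hcon
              exact h1 ⟨h2, h3, hcon⟩
            obtain ⟨w, hw, hw'⟩ := this
            rw [Finset.prod_eq_zero hw (Set.indicator_of_notMem hw' _), mul_zero]
          · rw [Set.indicator_of_notMem (show S v₀ ∉ Set.Iic a from h3), mul_zero, zero_mul]
        · rw [Set.indicator_of_notMem h2, zero_mul, zero_mul]
    rw [← lintegral_const_mul' _ _ ENNReal.ofReal_ne_top]
    simp_rw [hslice]
    rw [lintegral_pi_prod_eq_prod hf]
    refine Finset.prod_congr rfl fun w _ => ?_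
    by_cases hw : w = v₀
    · subst hw
      simp only [f, g, slotMeasure, if_true]
      rw [lintegral_const_mul' _ _ (by by_cases h : a ∈ s w <;> simp [h]),
        lintegral_convPow_stayLaw (hθ w) ha, withDensity_apply _ (hs w),
        ← lintegral_indicator (hs w), lintegral_dirac' _ ((measurable_localTimeDensity _ _).indicator (hs w))]
      by_cases h : a ∈ s w <;> simp [h]
    · obtain ⟨j, hj⟩ := Nat.exists_eq_succ_of_ne_zero (hk w hw)
      simp only [f, g, slotMeasure, hw, if_false, add_zero]
      rw [lintegral_indicator_one (hs w), hj, Nat.succ_eq_add_one, convPow_stayLaw (hθ w)]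
  have hpi := pi_withDensity_prod (lam := slotMeasure v₀ a) hg hg'
  rw [refMeasure, ← withDensity_apply _ hB, ← hpi, key, Measure.smul_apply, smul_eq_mul,
    Measure.map_apply hφ hB, Measure.restrict_apply (hφ hB), Set.inter_comm]
  rfl

end ReferenceMeasure

/-! ### Joint law of chain and stays, and absence of explosion. -/

section JointLaw

variable {V : Type*} [Fintype V] [DecidableEq V] {N : Network V} {v₀ : V}
  {Ω : Type*} [MeasurableSpace Ω] {μ : Measure Ω} {X : ℝ≥0 → Ω → V}

variable [IsProbabilityMeasure μ]

/-- The joint law of the jump chain and the stays, including the last one. -/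
lemma Network.IsWalk.map_holding (hX : N.IsWalk v₀ μ X)
    (hr : ∀ ω s, ∀ᶠ r in 𝓝[>] s, X r ω = X s ω) (hpos : ∀ w, 0 < N.total w)
    (hesc : ∀ w, 0 < N.escape w) (n : ℕ) (y : ℕ → V) (h0 : y 0 = v₀)
    (hy : ∀ i < n, y i ≠ y (i + 1)) :
    (μ.restrict {ω | ∀ i ≤ n, jumpState (fun s => X s ω) i = y i}).map
        (fun ω (i : Fin (n + 1)) => N.holding (fun s => X s ω) i)
      = ((∏ i ∈ Finset.range n, N.offDiag (y i) (y (i + 1))) * ENNReal.ofReal (N.escape (y n))) •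
        Measure.pi fun i : Fin (n + 1) => stayLaw (N.escape (y i)) := by
  have hms := measurableSet_jumpState hX.measurable hr
  have hmh := measurable_holding N hX.measurable hr
  have hfin : ∀ w, IsFiniteMeasure (stayLaw (N.escape w)) := fun w => isFiniteMeasure_stayLaw (hesc w)
  -- As `stayLaw` has mass `1 / escape`, each jump probability loses its denominator and becomes a
  -- conductance. The last stay has no recorded jump and keeps its normalising factor.
  let k : Fin (n + 1) → ℝ≥0∞ := fun i =>
    if (i : ℕ) < n then N.offDiag (y i) (y (i + 1)) else ENNReal.ofReal (N.escape (y i))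
  have hod : ∀ a b, N.offDiag a b ≠ ⊤ := by
    intro a b; unfold Network.offDiag; split_ifs <;> simp
  have hk : ∀ i, k i ≠ ⊤ := by
    intro i
    simp only [k]
    split_ifs
    · exact hod _ _
    · simp
  have hkprod : ∏ i, k i = (∏ i ∈ Finset.range n, N.offDiag (y i) (y (i + 1))) *
      ENNReal.ofReal (N.escape (y n)) := by
    rw [Fin.prod_univ_castSucc, Finset.prod_range]
    simp [k]
  rw [← hkprod, ← pi_smul_measure hk]
  symm
  have hfin' : ∀ i : Fin (n + 1), IsFiniteMeasure (k i • stayLaw (N.escape (y i))) :=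
    fun i => Measure.smul_finite _ (hk i)
  refine Measure.pi_eq_generateFrom (C := fun _ => Set.range Set.Ioi)
    (fun i => by rw [← borel_eq_generateFrom_Ioi]; exact (BorelSpace.measurable_eq).symm)
    (fun i => by exact isPiSystem_Ioi) (fun i => ?_) ?_
  · refine ⟨fun m => Set.Ioi (-(m : ℝ)), fun m => ⟨_, rfl⟩, fun m => measure_lt_top _ _, ?_⟩
    refine Set.eq_univ_of_forall fun x => ?_
    obtain ⟨m, hm⟩ := exists_nat_gt (-x)
    exact Set.mem_iUnion.2 ⟨m, by simp only [Set.mem_Ioi]; linarith⟩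
  · intro s hs
    choose r hr' using hs
    have hsm : ∀ i, MeasurableSet (s i) := fun i => hr' i ▸ measurableSet_Ioi
    have hHm : Measurable fun ω (i : Fin (n + 1)) => N.holding (fun s => X s ω) i :=
      measurable_pi_lambda _ fun i => hmh i
    rw [Measure.map_apply hHm (MeasurableSet.univ_pi hsm),
      Measure.restrict_apply (hHm (MeasurableSet.univ_pi hsm))]
    let r' : ℕ → ℝ := fun i => r (Fin.ofNat (n + 1) i)
    have hr'' : ∀ i : Fin (n + 1), r' i = r i := by intro i; simp [r']
    -- The given law controls a stay only together with the next jump, so the last stay is handled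
    -- by summing over the vertex `z` that follows it.
    let F : V → Set Ω := fun z => {ω | (∀ i ≤ n + 1,
        jumpState (fun s => X s ω) i = Function.update y (n + 1) z i) ∧
        ∀ i < n + 1, r' i < N.holding (fun s => X s ω) i}
    have hunion : (fun ω (i : Fin (n + 1)) => N.holding (fun s => X s ω) i) ⁻¹' (Set.univ.pi s) ∩
        {ω | ∀ i ≤ n, jumpState (fun s => X s ω) i = y i} = ⋃ z, F z := by
      ext ω
      simp only [Set.mem_inter_iff, Set.mem_preimage, Set.mem_univ_pi, ← hr', Set.mem_Ioi,
        Set.mem_iUnion, F, Set.mem_ofPred_eq]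
      constructor
      · rintro ⟨h1, h2⟩
        refine ⟨jumpState (fun s => X s ω) (n + 1), fun i hi => ?_, fun i hi => ?_⟩
        · rcases hi.lt_or_eq with h | rfl
          · rw [Function.update_of_ne h.ne]
            exact h2 i (by omega)
          · simp
        · have := h1 ⟨i, hi⟩
          rwa [← hr''] at this
      · rintro ⟨z, h1, h2⟩
        refine ⟨fun i => ?_, fun i hi => ?_⟩
        · rw [← hr'']; exact h2 i i.2
        · have := h1 i (by omega)
          rwa [Function.update_of_ne (by omega)] at this
    have hFm : ∀ z, MeasurableSet (F z) := by
      intro z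
      have e : F z = (⋂ i, ⋂ (_ : i ≤ n + 1),
          {ω | jumpState (fun s => X s ω) i = Function.update y (n + 1) z i}) ∩
          ⋂ i, ⋂ (_ : i < n + 1), {ω | r' i < N.holding (fun s => X s ω) i} := by
        ext ω; simp [F]
      rw [e]
      exact (MeasurableSet.iInter fun i => MeasurableSet.iInter fun _ => hms i _).inter
        (MeasurableSet.iInter fun i => MeasurableSet.iInter fun _ =>
          measurableSet_lt measurable_const (hmh i))
    have hdisj : Pairwise (Function.onFun Disjoint F) := by
      intro z z' hne
      refine Set.disjoint_left.2 fun ω h h' => hne ?_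
      have h1 := h.1 (n + 1) le_rfl
      have h2 := h'.1 (n + 1) le_rfl
      rw [Function.update_self] at h1 h2
      exact h1.symm.trans h2
    rw [hunion, measure_iUnion hdisj hFm, tsum_fintype]
    let G : ℕ → ℝ≥0∞ := fun i =>
      ENNReal.ofReal (Real.exp (-(N.escape (y i) * max (r' i) 0)))
    have hF : ∀ z, μ (F z) = (∏ i ∈ Finset.range n, (N.stepProb (y i) (y (i + 1)) * G i)) *
        (N.stepProb (y n) z * G n) := by
      intro z
      by_cases hz : z = y n
      · have : μ (F z) = 0 := by
          refine measure_mono_null ?_ (ae_iff.1 (hX.ae_jumpTime_ne_top hr hpos hesc))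
          intro ω hω
          simp only [Set.mem_ofPred_eq, not_forall, not_not]
          by_contra! hcon
          have h1 := hω.1 n (by omega)
          have h2 := hω.1 (n + 1) le_rfl
          rw [Function.update_of_ne (by omega)] at h1
          rw [Function.update_self] at h2
          exact jumpState_ne_succ (hr ω) (hcon (n + 1)) (h1.trans (hz.symm.trans h2.symm))
        rw [this, hz]
        simp [Network.stepProb, Network.offDiag]
      · have hlaw := hX.law_holding hr hpos hesc (n + 1) (Function.update y (n + 1) z) r'
          (by rw [Function.update_of_ne (by omega)]; exact h0) (by
            intro i hi
            rw [Function.update_of_ne (by omega)]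
            rcases (Nat.lt_succ_iff.1 hi).lt_or_eq with h | rfl
            · rw [Function.update_of_ne (by omega)]; exact hy i h
            · rw [Function.update_self]; exact fun h => hz h.symm)
        refine hlaw.trans ?_
        rw [Finset.prod_range_succ, Function.update_self, Function.update_of_ne (by omega)]
        congr 1
        refine Finset.prod_congr rfl fun i hi => ?_
        have hi' := Finset.mem_range.1 hi
        rw [Function.update_of_ne (by omega), Function.update_of_ne (by omega)]
    simp_rw [hF]
    rw [← Finset.mul_sum, ← Finset.sum_mul, N.sum_stepProb hpos hesc, one_mul,
      Fin.prod_univ_castSucc, Finset.prod_range]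
    have hIoi : ∀ i : Fin (n + 1), stayLaw (N.escape (y i)) (s i)
        = G i / ENNReal.ofReal (N.escape (y i)) := by
      intro i
      rw [← hr' i, stayLaw_Ioi (hesc _), ← hr'']
    congr 1
    · refine Finset.prod_congr rfl fun i _ => ?_
      rw [Measure.smul_apply, smul_eq_mul, hIoi]
      simp only [k, Fin.val_castSucc, i.2, if_true, Network.stepProb, div_eq_mul_inv]
      ring
    · rw [Measure.smul_apply, smul_eq_mul, hIoi]
      simp only [k, Fin.val_last, lt_irrefl, if_false]
      exact (ENNReal.mul_div_cancel (by simpa using hesc (y n)) ENNReal.ofReal_ne_top).symm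

/-- The walk does not explode. -/
lemma Network.IsWalk.ae_unbounded (hX : N.IsWalk v₀ μ X)
    (hr : ∀ ω s, ∀ᶠ r in 𝓝[>] s, X r ω = X s ω) (hpos : ∀ w, 0 < N.total w)
    (hesc : ∀ w, 0 < N.escape w) :
    ∀ᵐ ω ∂μ, ∀ s : ℝ≥0, ∃ k, (s : ℝ≥0∞) < jumpTime (fun s => X s ω) k := by
  have hms := measurableSet_jumpState hX.measurable hr
  have hmh := measurable_holding N hX.measurable hr
  have hfin : ∀ w, IsFiniteMeasure (stayLaw (N.escape w)) := fun w => isFiniteMeasure_stayLaw (hesc w)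
  have hnull : ∀ m : ℕ, μ {ω | ∀ i, N.holding (fun s => X s ω) i ≤ m} = 0 := by
    intro m
    -- This is the probability that a stay at `w` lasts at most `m` in local time. It is below one,
    -- uniformly because `V` is finite, so short stays forever have geometrically vanishing
    -- probability.
    let q : V → ℝ≥0∞ := fun w => ENNReal.ofReal (N.escape w) * stayLaw (N.escape w) (Set.Iic m)
    have hq : ∀ w, q w < 1 := by
      intro w
      have h0 : ENNReal.ofReal (N.escape w) ≠ 0 := by simpa using hesc w
      have h1 := measure_add_measure_compl (μ := stayLaw (N.escape w))
        (measurableSet_Iic (a := (m : ℝ)))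
      rw [stayLaw_univ (hesc w), Set.compl_Iic, stayLaw_Ioi (hesc w)] at h1
      have h2 : stayLaw (N.escape w) (Set.Iic (m : ℝ)) < (ENNReal.ofReal (N.escape w))⁻¹ := by
        rw [← h1]
        refine ENNReal.lt_add_right (measure_ne_top _ _) ?_
        refine (ENNReal.div_pos ?_ ENNReal.ofReal_ne_top).ne'
        simpa using Real.exp_pos _
      calc q w < ENNReal.ofReal (N.escape w) * (ENNReal.ofReal (N.escape w))⁻¹ :=
            (ENNReal.mul_lt_mul_iff_right h0 ENNReal.ofReal_ne_top).2 h2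
        _ = 1 := ENNReal.mul_inv_cancel h0 ENNReal.ofReal_ne_top
    obtain ⟨c, hc1, hc⟩ : ∃ c : ℝ≥0∞, c < 1 ∧ ∀ w, q w ≤ c :=
      ⟨Finset.univ.sup q, (Finset.sup_lt_iff (by simp)).2 fun w _ => hq w,
        fun w => Finset.le_sup (Finset.mem_univ w)⟩
    have hbound : ∀ n : ℕ, μ {ω | ∀ i, N.holding (fun s => X s ω) i ≤ m} ≤ c ^ (n + 1) := by
      intro n
      let E : (Fin (n + 1) → V) → Set Ω := fun y =>
        {ω | ∀ i ≤ n, jumpState (fun s => X s ω) i = natPath y i}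
      let H : Ω → Fin (n + 1) → ℝ := fun ω i => N.holding (fun s => X s ω) i
      have hH : Measurable H := measurable_pi_lambda _ fun i => hmh i
      let D : Set (Fin (n + 1) → ℝ) := Set.univ.pi fun _ => Set.Iic (m : ℝ)
      have hD : MeasurableSet D := MeasurableSet.univ_pi fun _ => measurableSet_Iic
      have hsub : {ω | ∀ i, N.holding (fun s => X s ω) i ≤ m} ⊆ ⋃ y, H ⁻¹' D ∩ E y := by
        intro ω hω
        refine Set.mem_iUnion.2 ⟨fun i => jumpState (fun s => X s ω) i, ?_, ?_⟩
        · exact fun i _ => hω i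
        · intro i hi
          have := natPath_val (fun i : Fin (n + 1) => jumpState (fun s => X s ω) i) ⟨i, by omega⟩
          exact this.symm
      refine (measure_mono hsub).trans ((measure_iUnion_le _).trans ?_)
      rw [tsum_fintype, ← one_mul (c ^ (n + 1)), ← N.sum_chainProb (v₀ := v₀) hpos hesc n,
        Finset.sum_mul]
      refine Finset.sum_le_sum fun y _ => ?_
      by_cases h : natPath y 0 = v₀ ∧ ∀ i < n, natPath y i ≠ natPath y (i + 1)
      · have hmap := hX.map_holding hr hpos hesc n (natPath y) h.1 h.2
        rw [← Measure.restrict_apply (hH hD), ← Measure.map_apply hH hD, hmap, Measure.smul_apply, smul_eq_mul, Measure.pi_pi]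
        have h2 : N.chainProb v₀ y = ∏ i : Fin n, N.stepProb (y i.castSucc) (y i.succ) := by
          rw [Network.chainProb, if_pos (by rw [← natPath_zero y]; exact h.1), one_mul]
        rw [h2, prod_range_natPath y N.offDiag, Fin.prod_univ_castSucc]
        simp_rw [natPath_val]
        have h3 : natPath y n = y (Fin.last n) := natPath_val y (Fin.last n)
        have h4 : ∀ i : Fin n, N.offDiag (y i.castSucc) (y i.succ) *
            stayLaw (N.escape (y i.castSucc)) (Set.Iic m)
            = N.stepProb (y i.castSucc) (y i.succ) * q (y i.castSucc) := by
          intro i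
          simp only [q, Network.stepProb]
          rw [← mul_assoc, ENNReal.div_mul_cancel (by simpa using hesc _) ENNReal.ofReal_ne_top]
        calc _ = (∏ i : Fin n, (N.stepProb (y i.castSucc) (y i.succ) * q (y i.castSucc))) *
              q (y (Fin.last n)) := by
              rw [← Finset.prod_congr rfl fun i _ => h4 i, Finset.prod_mul_distrib, h3]
              ring
          _ ≤ (∏ i : Fin n, (N.stepProb (y i.castSucc) (y i.succ) * c)) * c :=
              mul_le_mul' (Finset.prod_le_prod' fun i _ => mul_le_mul_right (hc _) _) (hc _)
          _ = _ := by
              rw [Finset.prod_mul_distrib, Finset.prod_const, Finset.card_univ, Fintype.card_fin]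
              ring
      · have : μ (H ⁻¹' D ∩ E y) = 0 := by
          refine measure_mono_null Set.inter_subset_right ?_
          have hae : ∀ᵐ ω ∂μ, ω ∉ E y := by
            filter_upwards [hX.ae_jumpState_zero, hX.ae_jumpTime_ne_top hr hpos hesc] with ω h1 h2 h3
            refine h ⟨(h3 0 (Nat.zero_le _)).symm.trans h1, fun i hi => ?_⟩
            rw [← h3 i hi.le, ← h3 (i + 1) hi]
            exact jumpState_ne_succ (hr ω) (h2 (i + 1))
          have := ae_iff.1 hae
          simpa using this
        rw [this]
        exact zero_le
    exact le_antisymm (ge_of_tendsto' ((ENNReal.tendsto_pow_atTop_nhds_zero_of_lt_one hc1).comp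
      (tendsto_add_atTop_nat 1)) hbound) zero_le
  have hae : ∀ᵐ ω ∂μ, ∀ m : ℕ, ¬ ∀ i, N.holding (fun s => X s ω) i ≤ m := by
    rw [ae_all_iff]
    intro m
    rw [ae_iff]
    simpa using hnull m
  filter_upwards [hae, hX.ae_jumpTime_ne_top hr hpos hesc] with ω hω hfinite s
  by_contra! hcon
  -- If all jump times stayed below `s`, every stay would be bounded by this one constant.
  obtain ⟨m, hm⟩ := exists_nat_ge (∑ w, (s : ℝ) / N.total w)
  refine hω m fun i => le_trans ?_ hm
  have h1 : N.holding (fun s => X s ω) i ≤ s / N.total (jumpState (fun s => X s ω) i) := by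
    refine div_le_div_of_nonneg_right ?_ (hpos _).le
    have h2 := (ENNReal.toReal_le_toReal (hfinite (i + 1)) ENNReal.coe_ne_top).2 (hcon (i + 1))
    have h3 := ENNReal.toReal_nonneg (a := jumpTime (fun s => X s ω) i)
    rw [ENNReal.coe_toReal] at h2
    linarith
  exact h1.trans (Finset.single_le_sum (f := fun w => (s : ℝ) / N.total w)
    (fun w _ => div_nonneg s.2 (hpos w).le) (Finset.mem_univ _))

lemma Network.IsWalk.ae_regularTrajectory (hX : N.IsWalk v₀ μ X)
    (hr : ∀ ω s, ∀ᶠ r in 𝓝[>] s, X r ω = X s ω) (hpos : ∀ w, 0 < N.total w)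
    (hesc : ∀ w, 0 < N.escape w) : ∀ᵐ ω ∂μ, RegularTrajectory fun s => X s ω := by
  filter_upwards [hX.ae_jumpTime_ne_top hr hpos hesc, hX.ae_unbounded hr hpos hesc] with ω h1 h2
  exact ⟨hr ω, h1, h2⟩

end JointLaw

/-! ### Joint density of the embedded path and the local times. -/

section PathLaw

variable {V : Type*}

lemma stepWeight_append_singleton (c : V → V → ℝ≥0∞) (q : List V) (v₀ : V) :
    stepWeight c (q ++ [v₀])
      = ∏ i ∈ Finset.range q.length, c (q.getD i v₀) (q.getD (i + 1) v₀) := by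
  induction q with
  | nil => simp [stepWeight]
  | cons a q ih =>
    rw [List.length_cons, Finset.prod_range_succ']
    simp only [List.getD_cons_succ]
    rw [← ih, mul_comm]
    cases q with
    | nil => simp [stepWeight]
    | cons b q => simp [stepWeight]

lemma append_singleton_eq_map_range (q : List V) (v₀ : V) :
    q ++ [v₀] = (List.range (q.length + 1)).map fun i => q.getD i v₀ := by
  apply List.ext_getElem
  · simp
  · intro i h1 h2
    simp only [List.getElem_map, List.getElem_range]
    by_cases h : i < q.length
    · rw [List.getElem_append_left h]; simp [h]
    · rw [List.getElem_append_right (not_lt.1 h)]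
      simp [List.getD, List.getElem?_eq_none (not_lt.1 h)]

lemma getD_append_singleton (q : List V) (v₀ : V) (i : ℕ) :
    (q ++ [v₀]).getD i v₀ = q.getD i v₀ := by
  by_cases h : i < q.length
  · simp [h, List.getElem?_append_left h]
  · rw [List.getD_append_right _ _ _ _ (not_lt.1 h), List.getD_eq_default _ _ (not_lt.1 h)]
    cases i - q.length <;> simp

variable [Fintype V] [DecidableEq V] {N : Network V} {v₀ : V}
  {Ω : Type*} [MeasurableSpace Ω] {μ : Measure Ω} {X : ℝ≥0 → Ω → V}

/-- The joint density of the embedded path and the local times at the inverse local time. -/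
noncomputable def Network.pathDensity (N : Network V) (v₀ : V) (p : List V) (l : V → ℝ) : ℝ≥0∞ :=
  N.pathWeight v₀ l p * ∏ w, ENNReal.ofReal (Real.exp (-(N.escape w * l w)))

lemma RegularTrajectory.embeddedPath_eq_and_iff {x : ℝ≥0 → V} (hx : RegularTrajectory x)
    (hpos : ∀ w, 0 < N.total w) {t : ℝ} (ht : 0 ≤ t) {B : Set (V → ℝ)}
    (hB : B ⊆ {l | ∀ w, 0 < l w}) (p : List V) :
    (N.embeddedPath v₀ t x = p ∧ N.localTimesAt v₀ t x ∈ B) ↔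
      ∃ n, p = (List.range (n + 1)).map (jumpState x) ∧ jumpState x n = v₀ ∧
        N.stayTime x n v₀ ≤ t ∧ t < N.stayTime x n v₀ + N.holding x n ∧
        Function.update (N.stayTime x n) v₀ t ∈ B := by
  constructor
  · rintro ⟨h1, h2⟩
    -- An infinite inverse local time has `toReal` equal to zero, so all recorded local times
    -- vanish, which the positivity of `B` excludes.
    have hne : N.invLocalTime v₀ x t ≠ ⊤ := by
      intro h
      have := hB h2 v₀
      simp [Network.localTimesAt, h, Network.localTime] at this
    obtain ⟨n, hn, h3, h4⟩ := hx.exists_stay N hpos ht hne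
    obtain ⟨h5, h6⟩ := hx.embeddedPath_and_localTimesAt N hpos hn h3 h4
    exact ⟨n, h1 ▸ h5, hn, h3, h4, h6 ▸ h2⟩
  · rintro ⟨n, h1, hn, h3, h4, h2⟩
    obtain ⟨h5, h6⟩ := hx.embeddedPath_and_localTimesAt N hpos hn h3 h4
    exact ⟨h5.trans h1.symm, h6 ▸ h2⟩

lemma Network.pathDensity_append {q : List V} (hhead : (q ++ [v₀]).head? = some v₀)
    (hall : ∀ w, w ∈ q ++ [v₀]) (l : V → ℝ) :
    N.pathDensity v₀ (q ++ [v₀]) l = stepWeight N.offDiag (q ++ [v₀]) *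
      ∏ w, localTimeDensity (N.escape w) (q.count w + if w = v₀ then 1 else 0) (l w) := by
  rw [Network.pathDensity, Network.pathWeight, if_pos ⟨hhead, by simp, hall⟩, mul_assoc,
    ← Finset.prod_mul_distrib]
  congr 1
  refine Finset.prod_congr rfl fun w _ => ?_
  rw [localTimeDensity, mul_comm, List.count_append]
  congr 3
  rw [List.count_singleton]
  simp [@eq_comm _ v₀ w]

lemma measurable_pathDensity (p : List V) : Measurable (N.pathDensity v₀ p) := by
  unfold Network.pathDensity Network.pathWeight visitWeight
  split_ifs
  · fun_prop
  · simp only [zero_mul]; exact measurable_const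

variable [IsProbabilityMeasure μ]

/-- For a fixed path the event depends, up to a null set, only on finitely many jump states and
stays, whose law is known from `map_holding`. This is also why null-measurability is what comes out.
-/
lemma Network.IsWalk.measure_path_and_localTimes (hX : N.IsWalk v₀ μ X)
    (hr : ∀ ω s, ∀ᶠ r in 𝓝[>] s, X r ω = X s ω) (hpos : ∀ w, 0 < N.total w)
    (hesc : ∀ w, 0 < N.escape w) {t : ℝ} (ht : 0 ≤ t) {B : Set (V → ℝ)} (hBm : MeasurableSet B)
    (hB : B ⊆ {l | ∀ w, 0 < l w}) (p : List V) :
    NullMeasurableSet {ω | N.embeddedPath v₀ t (fun s => X s ω) = p ∧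
        N.localTimesAt v₀ t (fun s => X s ω) ∈ B} μ ∧
      μ {ω | N.embeddedPath v₀ t (fun s => X s ω) = p ∧
        N.localTimesAt v₀ t (fun s => X s ω) ∈ B}
      = ∫⁻ l in B, N.pathDensity v₀ p l ∂(refMeasure v₀ t) := by
  have hreg := hX.ae_regularTrajectory hr hpos hesc
  have hms := measurableSet_jumpState hX.measurable hr
  have hmh := measurable_holding N hX.measurable hr
  set E := {ω | N.embeddedPath v₀ t (fun s => X s ω) = p ∧
        N.localTimesAt v₀ t (fun s => X s ω) ∈ B} with hE
  -- A path failing one of these conditions is almost surely not realised with local times in `B`,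
  -- and its density vanishes as well: a repeated vertex gives a zero step weight.
  by_cases hgood : p.head? = some v₀ ∧ p.getLast? = some v₀ ∧ (∀ w, w ∈ p) ∧
      ∀ i, i + 1 < p.length → p.getD i v₀ ≠ p.getD (i + 1) v₀
  swap
  · have hnull : μ E = 0 := by
      have hae : ∀ᵐ ω ∂μ, ω ∉ E := by
        filter_upwards [hreg, hX.ae_jumpState_zero,
          hX.ae_jumpTime_ne_top hr hpos hesc] with ω hω h0 hfin hmem
        obtain ⟨n, h1, hn, -, -, h2⟩ := (hω.embeddedPath_eq_and_iff hpos ht hB p).1 hmem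
        have hmem : ∀ i ≤ n, jumpState (fun s => X s ω) i ∈ p := by
          intro i hi
          rw [h1]
          exact List.mem_map.2 ⟨i, by simp; omega, rfl⟩
        refine hgood ⟨?_, ?_, fun w => ?_, fun i hi => ?_⟩
        · rw [h1]; simpa [List.head?_range] using h0
        · rw [h1]; simpa [List.getLast?_range] using hn
        · by_contra hw
          have hne : w ≠ v₀ := fun h => hw (by rw [h, ← hn]; exact hmem n le_rfl)
          have hpw := hB h2 w
          rw [Function.update_of_ne hne, Network.stayTime,
            Finset.sum_eq_zero] at hpw
          · exact lt_irrefl _ hpw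
          · intro i hi
            refine if_neg fun h => hw ?_
            rw [← h]
            exact hmem i (Finset.mem_range.1 hi).le
        · rw [h1] at hi ⊢
          simp only [List.length_map, List.length_range] at hi
          rw [List.getD_eq_getElem _ _ (by simpa using (by omega : i < n + 1)),
            List.getD_eq_getElem _ _ (by simpa using hi)]
          simp only [List.getElem_map, List.getElem_range]
          exact jumpState_ne_succ (hr ω) (hfin (i + 1))
      simpa using ae_iff.1 hae
    refine ⟨NullMeasurableSet.of_null hnull, ?_⟩
    rw [hnull]
    have hz : ∀ l, N.pathDensity v₀ p l = 0 := by
      intro l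
      rw [Network.pathDensity, Network.pathWeight]
      split_ifs with h
      · have : stepWeight N.offDiag p = 0 := by
          by_contra hne
          refine hgood ⟨h.1, h.2.1, h.2.2, fun i hi heq => hne ?_⟩
          obtain ⟨q, rfl⟩ : ∃ q, p = q ++ [v₀] :=
            ⟨p.dropLast, (List.dropLast_append_getLast? v₀ h.2.1).symm⟩
          rw [getD_append_singleton, getD_append_singleton] at heq
          rw [stepWeight_append_singleton]
          refine Finset.prod_eq_zero (Finset.mem_range.2 (by simpa using hi)) ?_
          rw [heq, Network.offDiag, if_pos rfl]
        rw [this, zero_mul, zero_mul]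
      · rw [zero_mul]
    simp [hz]
  · obtain ⟨hhead, hlast, hall, hstep⟩ := hgood
    obtain ⟨q, rfl⟩ : ∃ q, p = q ++ [v₀] :=
      ⟨p.dropLast, (List.dropLast_append_getLast? v₀ hlast).symm⟩
    set n := q.length with hn
    let y : ℕ → V := fun i => q.getD i v₀
    have hyn : y n = v₀ := by simp [y, hn]
    have hy0 : y 0 = v₀ := by
      cases q with
      | nil => simp [y]
      | cons a q => simpa [y] using hhead
    have hyv : ∀ i < n, y i ≠ y (i + 1) := by
      intro i hi
      have := hstep i (by simpa using hi)
      rwa [getD_append_singleton, getD_append_singleton] at this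
    have hmap := hX.map_holding hr hpos hesc n y hy0 hyv
    let y' : Fin n → V := fun i => y i
    have hofn : List.ofFn y' = q := by
      apply List.ext_getElem
      · simp [hn]
      · intro i h1 h2
        simp [y', y, h2]
    let A : Set (Fin (n + 1) → ℝ) := {T | (blockSum y' (fun i => T i.castSucc) v₀ ≤ t ∧
      t < blockSum y' (fun i => T i.castSucc) v₀ + T (Fin.last n)) ∧
      Function.update (blockSum y' fun i => T i.castSucc) v₀ t ∈ B}
    let C : Set (ℝ × (V → ℝ)) := {z | (z.2 v₀ ≤ t ∧ t < z.2 v₀ + z.1) ∧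
      Function.update z.2 v₀ t ∈ B}
    have hφ : Measurable fun z : ℝ × (V → ℝ) => Function.update z.2 v₀ t := by
      refine measurable_pi_lambda _ fun w => ?_
      by_cases h : w = v₀
      · subst h; simp
      · simp only [Function.update_of_ne h]
        exact (measurable_pi_apply w).comp measurable_snd
    have hCm : MeasurableSet C := by
      refine MeasurableSet.inter (MeasurableSet.inter
        (measurableSet_le (f := fun z : ℝ × (V → ℝ) => z.2 v₀) (g := fun _ => t) (by fun_prop)
          measurable_const)
        (measurableSet_lt (f := fun _ => t) (g := fun z : ℝ × (V → ℝ) => z.2 v₀ + z.1)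
          measurable_const (by fun_prop))) (hφ hBm)
    have hb : Measurable fun T : Fin (n + 1) → ℝ =>
        ((T (Fin.last n), blockSum y' fun i => T i.castSucc) : ℝ × (V → ℝ)) :=
      (measurable_pi_apply _).prodMk ((measurable_blockSum y').comp
        (measurable_pi_lambda _ fun i => measurable_pi_apply _))
    have hAm : MeasurableSet A := hb hCm
    have hH : Measurable fun ω (i : Fin (n + 1)) => N.holding (fun s => X s ω) i :=
      measurable_pi_lambda _ fun i => hmh i
    set F := (fun ω (i : Fin (n + 1)) => N.holding (fun s => X s ω) i) ⁻¹' A ∩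
        {ω | ∀ i ≤ n, jumpState (fun s => X s ω) i = y i} with hF
    have hFm : MeasurableSet F := by
      refine (hH hAm).inter ?_
      simp only [Set.ofPred_forall]
      exact MeasurableSet.iInter fun i => MeasurableSet.iInter fun _ => hms i _
    have hEF : E =ᵐ[μ] F := by
      filter_upwards [hreg] with ω hω
      refine propext ?_
      change _ ↔ (fun (i : Fin (n + 1)) => N.holding (fun s => X s ω) i) ∈ A ∧
        ∀ i ≤ n, jumpState (fun s => X s ω) i = y i
      refine (hω.embeddedPath_eq_and_iff hpos ht hB (q ++ [v₀])).trans ?_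
      have hst : (∀ i ≤ n, jumpState (fun s => X s ω) i = y i) →
          N.stayTime (fun s => X s ω) n
            = blockSum y' fun i : Fin n => N.holding (fun s => X s ω) i := by
        intro h
        funext w
        rw [Network.stayTime, Finset.sum_range, blockSum]
        refine Finset.sum_congr rfl fun i _ => ?_
        rw [h i i.2.le]
      constructor
      · rintro ⟨m, h1, h2, h3, h4, h5⟩
        have hm : m = n := by
          have := congrArg List.length h1
          simp at this
          omega
        subst hm
        have hy : ∀ i ≤ n, jumpState (fun s => X s ω) i = y i := by
          intro i hi
          rw [append_singleton_eq_map_range] at h1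
          have := List.map_inj_left.1 h1 i (by simp; omega)
          exact this.symm
        rw [hst hy] at h3 h4 h5
        exact ⟨⟨⟨h3, h4⟩, h5⟩, hy⟩
      · rintro ⟨⟨⟨h3, h4⟩, h5⟩, hy⟩
        refine ⟨n, ?_, (hy n le_rfl).trans hyn, ?_, ?_, ?_⟩
        · rw [append_singleton_eq_map_range]
          refine List.map_inj_left.2 fun i hi => (hy i ?_).symm
          simp at hi; omega
        · rw [hst hy]; exact h3
        · rw [hst hy]; exact h4
        · rw [hst hy]; exact h5
    refine ⟨hFm.nullMeasurableSet.congr hEF.symm, ?_⟩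
    have hfin : ∀ w, IsFiniteMeasure (stayLaw (N.escape w)) :=
      fun w => isFiniteMeasure_stayLaw (hesc w)
    -- The last coordinate is the straddling stay; the others are grouped by vertex, the final visit
    -- to `v₀` being excluded from `q`.
    have hpush : (Measure.pi fun i : Fin (n + 1) => stayLaw (N.escape (y i))).map
        (fun T : Fin (n + 1) → ℝ =>
          ((T (Fin.last n), blockSum y' fun i => T i.castSucc) : ℝ × (V → ℝ)))
        = (stayLaw (N.escape v₀)).prod
          (Measure.pi fun w => convPow (stayLaw (N.escape w)) (q.count w)) := by
      have h1 := map_blockSum (fun w => stayLaw (N.escape w)) y'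
      rw [hofn] at h1
      have h2 := (measurePreserving_piFinSuccAbove
        (fun i : Fin (n + 1) => stayLaw (N.escape (y i))) (Fin.last n)).map_eq
      rw [← h1]
      conv_rhs => rw [← Measure.map_id (μ := stayLaw (N.escape v₀)),
        Measure.map_prod_map _ _ measurable_id (measurable_blockSum _)]
      have h3 : (stayLaw (N.escape v₀)).prod (Measure.pi fun i : Fin n => stayLaw (N.escape (y' i)))
          = (stayLaw (N.escape (y (Fin.last n : Fin (n + 1))))).prod (Measure.pi fun j : Fin n =>
            stayLaw (N.escape (y ((Fin.last n).succAbove j : Fin (n + 1))))) := by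
        simp [hyn, y']
      rw [h3, ← h2, Measure.map_map (measurable_id.prodMap (measurable_blockSum _))
        (MeasurableEquiv.measurable _)]
      congr 1
      funext T
      simp only [Function.comp, Prod.map, MeasurableEquiv.piFinSuccAbove_apply]
      simp [Fin.insertNthEquiv]
      rfl
    rw [measure_congr hEF, hF, ← Measure.restrict_apply (hH hAm), ← Measure.map_apply hH hAm, hmap,
      Measure.smul_apply, smul_eq_mul, hyn, mul_assoc]
    have hAC : A = (fun T : Fin (n + 1) → ℝ =>
        ((T (Fin.last n), blockSum y' fun i => T i.castSucc) : ℝ × (V → ℝ))) ⁻¹' C := rfl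
    rw [hAC, ← Measure.map_apply hb hCm, hpush, stayLaw_blockLaw_apply ht hesc ?_ hBm]
    · simp_rw [Network.pathDensity_append hhead hall]
      rw [lintegral_const_mul, stepWeight_append_singleton]
      refine Finset.measurable_prod _ fun w _ => ?_
      exact (measurable_localTimeDensity _ _).comp (measurable_pi_apply w)
    · intro w hw
      have := hall w
      simp [hw] at this
      exact (List.count_pos_iff.2 this).ne'

end PathLaw

/-! ### From joint densities to the conditional law. -/

section ConditionalLaw

/-- Conditional laws from joint densities that are continuous along a conull set. -/
lemma isConditionalLaw_of_density {Ω S ι : Type*} [Fintype ι] [Countable S] [MeasurableSpace Ω]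
    {μ : Measure Ω} [IsProbabilityMeasure μ] {Z : Ω → S} {L : Ω → ι → ℝ} {ℓ : ι → ℝ}
    {lam : Measure (ι → ℝ)} {ρ : S → (ι → ℝ) → ℝ≥0∞} {O K : Set (ι → ℝ)} (hO : IsOpen O)
    (hℓO : ℓ ∈ O) (hρ : ∀ p, Measurable (ρ p))
    (hnull : ∀ B ⊆ O, MeasurableSet B → ∀ p, NullMeasurableSet {ω | Z ω = p ∧ L ω ∈ B} μ)
    (hlaw : ∀ B ⊆ O, MeasurableSet B → ∀ p, μ {ω | Z ω = p ∧ L ω ∈ B} = ∫⁻ l in B, ρ p l ∂lam)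
    (hK : ∀ᵐ l ∂lam, l ∈ K) (hlam : ∀ U ∈ 𝓝 ℓ, lam U ≠ 0)
    (hcont : ∀ A : Set S, Tendsto (fun l => ∑' p, A.indicator (fun p => ρ p l) p) (𝓝[K] ℓ)
      (𝓝 (∑' p, A.indicator (fun p => ρ p ℓ) p)))
    (h0 : ∑' p, ρ p ℓ ≠ 0) (htop : ∑' p, ρ p ℓ ≠ ⊤) :
    IsConditionalLaw μ Z L ℓ (PMF.normalize (fun p => ρ p ℓ) h0 htop) := by
  let f : Set S → (ι → ℝ) → ℝ≥0∞ := fun A l => ∑' p, A.indicator (fun p => ρ p l) p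
  have hfm : ∀ A, Measurable (f A) := by
    intro A
    refine Measurable.tsum fun p => ?_
    by_cases hp : p ∈ A
    · simpa [hp] using hρ p
    · simp [hp]
  have hfuniv : ∀ l, f Set.univ l = ∑' p, ρ p l := fun l => by simp [f]
  have hA : ∀ (A : Set S) B, B ⊆ O → MeasurableSet B →
      μ {ω | Z ω ∈ A ∧ L ω ∈ B} = ∫⁻ l in B, f A l ∂lam := by
    intro A B hBO hB
    have hunion : {ω | Z ω ∈ A ∧ L ω ∈ B} = ⋃ p ∈ A, {ω | Z ω = p ∧ L ω ∈ B} := by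
      ext ω; simp
    rw [hunion, measure_biUnion₀ A.to_countable]
    · simp only [f]
      rw [lintegral_tsum, tsum_subtype A fun p => μ {ω | Z ω = p ∧ L ω ∈ B}]
      · refine tsum_congr fun p => ?_
        by_cases hp : p ∈ A
        · simp [hp, hlaw B hBO hB p]
        · simp [hp]
      · intro p
        by_cases hp : p ∈ A
        · simpa [hp] using (hρ p).aemeasurable
        · simp [hp]
    · intro p _ p' _ hne
      refine Disjoint.aedisjoint (Set.disjoint_left.2 fun ω h h' => hne (h.1.symm.trans h'.1))
    · exact fun p _ => hnull B hBO hB p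
  have hL : ∀ B, B ⊆ O → MeasurableSet B → μ {ω | L ω ∈ B} = ∫⁻ l in B, f Set.univ l ∂lam := by
    intro B hBO hB
    simpa using hA Set.univ B hBO hB
  have hcu := hcont Set.univ
  have hf0 : f Set.univ ℓ ≠ 0 := by rw [hfuniv]; exact h0
  have hft : f Set.univ ℓ ≠ ⊤ := by rw [hfuniv]; exact htop
  refine ⟨fun B hB => ?_, fun A => ?_⟩
  · have hev : ∀ᶠ l in 𝓝[K] ℓ, f Set.univ ℓ / 2 < f Set.univ l :=
      hcu.eventually (lt_mem_nhds (ENNReal.half_lt_self hf0 hft))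
    obtain ⟨U, hU, hUℓ, hUK⟩ := mem_nhdsWithin.1 hev
    obtain ⟨W, hWB, hW, hWℓ⟩ := mem_nhds_iff.1 hB
    have hopen : IsOpen (U ∩ W ∩ O) := (hU.inter hW).inter hO
    have hpos : 0 < f Set.univ ℓ / 2 * lam (U ∩ W ∩ O) :=
      ENNReal.mul_pos (ENNReal.half_pos hf0).ne'
        (hlam _ (hopen.mem_nhds ⟨⟨hUℓ, hWℓ⟩, hℓO⟩))
    refine lt_of_lt_of_le hpos ?_
    calc _ = ∫⁻ _ in U ∩ W ∩ O, f Set.univ ℓ / 2 ∂lam := by rw [setLIntegral_const]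
      _ ≤ ∫⁻ l in U ∩ W ∩ O, f Set.univ l ∂lam := by
          refine setLIntegral_mono_ae (hfm _).aemeasurable ?_
          filter_upwards [hK] with l hl hmem
          exact le_of_lt (hUK ⟨hmem.1.1, hl⟩)
      _ = μ {ω | L ω ∈ U ∩ W ∩ O} := (hL _ Set.inter_subset_right hopen.measurableSet).symm
      _ ≤ _ := measure_mono fun ω h => hWB h.1.2
  · have hν : (PMF.normalize (fun p => ρ p ℓ) h0 htop).toOuterMeasure A
        = f A ℓ / f Set.univ ℓ := by
      rw [PMF.toOuterMeasure_apply, hfuniv, ENNReal.div_eq_inv_mul, ← ENNReal.tsum_mul_left]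
      refine tsum_congr fun p => ?_
      by_cases hp : p ∈ A
      · simp [hp, PMF.normalize_apply, mul_comm]
      · simp [hp]
    have hle : ∀ l, f A l ≤ f Set.univ l := fun l =>
      ENNReal.tsum_le_tsum fun p => Set.indicator_le_indicator_of_subset (Set.subset_univ A)
        (fun _ => zero_le) p
    rw [hν]
    have hlim : Tendsto (fun l => f A l / f Set.univ l) (𝓝[K] ℓ) (𝓝 (f A ℓ / f Set.univ ℓ)) :=
      ENNReal.Tendsto.div (hcont A) (Or.inr hf0) hcu (Or.inl hft)
    have hat : f A ℓ / f Set.univ ℓ ≠ ⊤ :=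
      ENNReal.div_ne_top (ne_top_of_le_ne_top hft (hle ℓ)) hf0
    set a := f A ℓ / f Set.univ ℓ with ha
    rw [ENNReal.tendsto_nhds hat]
    intro ε hε
    -- Near `ℓ` in `K` the ratio of densities is within `ε` of its limit. Integrating the two
    -- inequalities over any small `B` bounds the ratio of probabilities, whatever the shape of `B`.
    have hev : ∀ᶠ l in 𝓝[K] ℓ, f A l / f Set.univ l ∈ Set.Icc (a - ε) (a + ε) ∧
        f Set.univ l ≠ 0 ∧ f Set.univ l ≠ ⊤ :=
      ((ENNReal.tendsto_nhds hat).1 hlim ε hε).and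
        ((hcu.eventually_ne hf0).and (hcu.eventually_ne hft))
    obtain ⟨U, hU, hUℓ, hUK⟩ := mem_nhdsWithin.1 hev
    refine eventually_inf_principal.2 (eventually_smallSets.2
      ⟨U ∩ O, (hU.inter hO).mem_nhds ⟨hUℓ, hℓO⟩, fun B hBU hB => ?_⟩)
    have hBO : B ⊆ O := hBU.trans Set.inter_subset_right
    have hb0 : μ {ω | L ω ∈ B} ≠ 0 := hB.2.ne'
    have hbt : μ {ω | L ω ∈ B} ≠ ⊤ := measure_ne_top _ _
    rw [hA A B hBO hB.1, hL B hBO hB.1] at *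
    have hle' : ∀ᵐ l ∂lam, l ∈ B → (a - ε) * f Set.univ l ≤ f A l ∧
        f A l ≤ (a + ε) * f Set.univ l := by
      filter_upwards [hK] with l hl hmem
      obtain ⟨⟨h1, h2⟩, h3, h4⟩ := hUK ⟨(hBU hmem).1, hl⟩
      exact ⟨(ENNReal.le_div_iff_mul_le (Or.inl h3) (Or.inl h4)).1 h1,
        (ENNReal.div_le_iff h3 h4).1 h2⟩
    constructor
    · rw [ENNReal.le_div_iff_mul_le (Or.inl hb0) (Or.inl hbt), ← lintegral_const_mul _ (hfm _)]
      refine setLIntegral_mono_ae (hfm _).aemeasurable ?_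
      filter_upwards [hle'] with l hl hmem using (hl hmem).1
    · rw [ENNReal.div_le_iff hb0 hbt, ← lintegral_const_mul _ (hfm _)]
      refine setLIntegral_mono_ae ((hfm _).const_mul _).aemeasurable ?_
      filter_upwards [hle'] with l hl hmem using (hl hmem).2

lemma IsConditionalLaw.congr {Ω S ι : Type*} [Fintype ι] [MeasurableSpace Ω]
    {μ : Measure Ω} {Z Z' : Ω → S} {L L' : Ω → ι → ℝ} {ℓ : ι → ℝ} {ν : PMF S}
    (h : IsConditionalLaw μ Z L ℓ ν) (hZL : ∀ᵐ ω ∂μ, Z ω = Z' ω ∧ L ω = L' ω) :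
    IsConditionalLaw μ Z' L' ℓ ν := by
  have h1 : ∀ B : Set (ι → ℝ), μ {ω | L ω ∈ B} = μ {ω | L' ω ∈ B} := by
    intro B
    refine measure_congr ?_
    filter_upwards [hZL] with ω hω
    refine propext ?_
    change L ω ∈ B ↔ L' ω ∈ B
    rw [hω.2]
  have h2 : ∀ (A : Set S) (B : Set (ι → ℝ)),
      μ {ω | Z ω ∈ A ∧ L ω ∈ B} = μ {ω | Z' ω ∈ A ∧ L' ω ∈ B} := by
    intro A B
    refine measure_congr ?_
    filter_upwards [hZL] with ω hω
    refine propext ?_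
    change Z ω ∈ A ∧ L ω ∈ B ↔ Z' ω ∈ A ∧ L' ω ∈ B
    rw [hω.1, hω.2]
  obtain ⟨hs, ht⟩ := h
  simp only [h1, h2] at hs ht
  exact ⟨hs, ht⟩

end ConditionalLaw

/-! ### The reference measure charges every neighbourhood of the given local times. -/

section ReferenceMeasurePositivity

variable {V : Type*} [Fintype V] [DecidableEq V]

lemma refMeasure_pi_ne_zero {v₀ : V} {t : ℝ} {s : V → Set ℝ} (hs : ∀ w, IsOpen (s w))
    (ht : t ∈ s v₀) (hne : ∀ w, w ≠ v₀ → (s w ∩ Set.Ioi 0).Nonempty) :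
    refMeasure v₀ t (Set.univ.pi s) ≠ 0 := by
  rw [refMeasure, Measure.pi_pi, Finset.prod_ne_zero_iff]
  intro w _
  by_cases hw : w = v₀
  · subst hw
    simp [slotMeasure, ht]
  · rw [slotMeasure, if_neg hw, Measure.restrict_apply (hs w).measurableSet]
    exact ((hs w).inter isOpen_Ioi).measure_ne_zero _ (hne w hw)

lemma refMeasure_nhds_ne_zero {v₀ : V} {ℓ : V → ℝ} (hℓ : ∀ w, 0 < ℓ w) {U : Set (V → ℝ)}
    (hU : U ∈ 𝓝 ℓ) : refMeasure v₀ (ℓ v₀) U ≠ 0 := by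
  obtain ⟨δ, hδ, hδU⟩ := Metric.mem_nhds_iff.1 hU
  rw [ball_pi _ hδ] at hδU
  have : refMeasure v₀ (ℓ v₀) (Set.univ.pi fun w => Metric.ball (ℓ w) δ) ≠ 0 :=
    refMeasure_pi_ne_zero (fun w => Metric.isOpen_ball) (Metric.mem_ball_self hδ)
      fun w _ => ⟨ℓ w, Metric.mem_ball_self hδ, hℓ w⟩
  exact fun h => this (measure_mono_null hδU h)

lemma ae_refMeasure (v₀ : V) (t : ℝ) : ∀ᵐ l ∂(refMeasure v₀ t), l v₀ = t := by
  have h : slotMeasure v₀ t v₀ {t}ᶜ = 0 := by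
    simp [slotMeasure]
  exact Measure.pi_eval_preimage_null (slotMeasure v₀ t) (i := v₀) h

end ReferenceMeasurePositivity

/-! ### Positivity, monotonicity and continuity of the weights. -/

section Existence

variable {V : Type*} [Fintype V] [DecidableEq V] {N : Network V}

omit [Fintype V] in
-- Follows the chain of edges one step at a time. Self-loops in the chain are skipped, since they
-- have zero weight in `offDiag`.
lemma Network.exists_extension {v₀ a b : V}
    (hab : Relation.ReflTransGen (fun a b => 0 < N.c a b) a b) {p : List V}
    (h1 : p.head? = some v₀) (h2 : p.getLast? = some a) (h3 : stepWeight N.offDiag p ≠ 0) :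
    ∃ p' : List V, p'.head? = some v₀ ∧ p'.getLast? = some b ∧ stepWeight N.offDiag p' ≠ 0 ∧
      ∀ w ∈ p, w ∈ p' := by
  induction hab with
  | refl => exact ⟨p, h1, h2, h3, fun _ h => h⟩
  | @tail b c _ hbc ih =>
    obtain ⟨p', h4, h5, h6, h7⟩ := ih
    by_cases h : b = c
    · exact ⟨p', h4, h ▸ h5, h6, h7⟩
    · refine ⟨p' ++ [c], ?_, by simp, ?_, fun w hw => List.mem_append_left _ (h7 w hw)⟩
      · rw [List.head?_append, h4]; rfl
      · obtain ⟨q, rfl⟩ : ∃ q, p' = q ++ [b] :=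
          ⟨p'.dropLast, (List.dropLast_append_getLast? b h5).symm⟩
        rw [List.append_assoc, List.singleton_append, stepWeight_append]
        refine mul_ne_zero h6 ?_
        simp [stepWeight, Network.offDiag, h, hbc]

/-- By connectedness a closed path from `v₀` can make an excursion to each vertex in turn. -/
lemma Network.exists_pathWeight_ne_zero (hconn : N.Connected) (v₀ : V) {l : V → ℝ}
    (hl : ∀ w, 0 < l w) : ∃ p, N.pathWeight v₀ l p ≠ 0 := by
  have h : ∀ s : Finset V, ∃ p : List V, p.head? = some v₀ ∧ p.getLast? = some v₀ ∧
      stepWeight N.offDiag p ≠ 0 ∧ ∀ w ∈ s, w ∈ p := by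
    intro s
    induction s using Finset.induction_on with
    | empty => exact ⟨[v₀], by simp, by simp, by simp [stepWeight], by simp⟩
    | insert a s _ ih =>
      obtain ⟨p, h1, h2, h3, h4⟩ := ih
      obtain ⟨p', g1, g2, g3, g4⟩ := N.exists_extension (hconn v₀ a) h1 h2 h3
      obtain ⟨p'', k1, k2, k3, k4⟩ := N.exists_extension (hconn a v₀) g1 g2 g3
      refine ⟨p'', k1, k2, k3, fun w hw => ?_⟩
      rcases Finset.mem_insert.1 hw with rfl | hw
      · exact k4 _ (List.mem_of_getLast? g2)
      · exact k4 _ (g4 _ (h4 _ hw))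
  obtain ⟨p, h1, h2, h3, h4⟩ := h Finset.univ
  refine ⟨p, ?_⟩
  rw [Network.pathWeight, if_pos ⟨h1, h2, fun w => h4 w (Finset.mem_univ w)⟩]
  refine mul_ne_zero h3 (Finset.prod_ne_zero_iff.2 fun w _ => ?_)
  rw [visitWeight, ne_eq, ENNReal.ofReal_eq_zero, not_le]
  have := hl w
  positivity

lemma Network.pathWeight_mono {v₀ : V} {l l' : V → ℝ} (hl : ∀ w, 0 ≤ l w) (h : ∀ w, l w ≤ l' w)
    (p : List V) : N.pathWeight v₀ l p ≤ N.pathWeight v₀ l' p := by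
  unfold Network.pathWeight
  split_ifs
  · refine mul_le_mul_right (Finset.prod_le_prod' fun w _ => ENNReal.ofReal_le_ofReal ?_) _
    have := hl w
    have := h w
    gcongr
  · exact le_rfl

lemma Network.continuous_pathDensity (v₀ : V) (p : List V) : Continuous (N.pathDensity v₀ p) := by
  have hs : stepWeight N.offDiag p ≠ ⊤ := by
    have hod : ∀ a b, N.offDiag a b ≠ ⊤ := by
      intro a b; unfold Network.offDiag; split_ifs <;> simp
    induction p with
    | nil => simp [stepWeight]
    | cons a p ih =>
      cases p with
      | nil => simp [stepWeight]
      | cons b p => exact ENNReal.mul_ne_top (hod a b) ih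
  by_cases h : p.head? = some v₀ ∧ p.getLast? = some v₀ ∧ ∀ w, w ∈ p
  · have e : N.pathDensity v₀ p = fun l => stepWeight N.offDiag p *
        (((∏ w, (l w ^ (p.count w - 1) / ((p.count w - 1).factorial : ℝ)).toNNReal) *
          ∏ w, (Real.exp (-(N.escape w * l w))).toNNReal : ℝ≥0) : ℝ≥0∞) := by
      funext l
      rw [Network.pathDensity, Network.pathWeight, if_pos h, mul_assoc]
      push_cast
      rfl
    rw [e]
    refine (ENNReal.continuous_const_mul hs).comp (ENNReal.continuous_coe.comp ?_)
    refine Continuous.mul ?_ ?_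
    · exact continuous_finsetProd _ fun w _ => continuous_real_toNNReal.comp (by fun_prop)
    · exact continuous_finsetProd _ fun w _ => continuous_real_toNNReal.comp (by fun_prop)
  · have e : N.pathDensity v₀ p = fun _ => 0 := by
      funext l
      rw [Network.pathDensity, Network.pathWeight, if_neg h, zero_mul]
    rw [e]
    exact continuous_const

end Existence

/-! ### Existence of the conditional law and reduction to the path weights. -/

section Main

variable {V : Type*} [Fintype V] [DecidableEq V] {N : Network V} {v₀ : V}
  {Ω : Type*} [MeasurableSpace Ω] {μ : Measure Ω} [IsProbabilityMeasure μ] {X : ℝ≥0 → Ω → V}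

/-- The densities integrate to at most one, so their sum is finite almost everywhere on a set of
positive reference measure. A vector `l` found there dominates `ℓ` and supplies the summable
majorant for nearby local times. Its `v₀` coordinate cannot be raised, as the reference measure
fixes it. -/
lemma Network.IsWalk.exists_tsum_pathWeight_ne_top (hX : N.IsWalk v₀ μ X)
    (hr : ∀ ω s, ∀ᶠ r in 𝓝[>] s, X r ω = X s ω) (hpos : ∀ w, 0 < N.total w)
    (hesc : ∀ w, 0 < N.escape w) {ℓ : V → ℝ} (hℓ : ∀ w, 0 < ℓ w) :
    ∃ l : V → ℝ, (∀ w, w ≠ v₀ → ℓ w < l w) ∧ l v₀ = ℓ v₀ ∧ ∑' p, N.pathWeight v₀ l p ≠ ⊤ := by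
  let s : V → Set ℝ := fun w => if w = v₀ then Set.Ioi 0 else Set.Ioi (ℓ w)
  have hs : ∀ w, IsOpen (s w) := by
    intro w
    simp only [s]
    split_ifs <;> exact isOpen_Ioi
  have hBm : MeasurableSet (Set.univ.pi s) := MeasurableSet.univ_pi fun w => (hs w).measurableSet
  have hB : Set.univ.pi s ⊆ {l | ∀ w, 0 < l w} := by
    intro l hl w
    have := hl w trivial
    by_cases h : w = v₀
    · simpa [s, h] using this
    · simp only [s, h, if_false] at this
      exact (hℓ w).trans this
  have hne : refMeasure v₀ (ℓ v₀) (Set.univ.pi s) ≠ 0 := by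
    refine refMeasure_pi_ne_zero hs (by simpa [s] using hℓ v₀) fun w hw => ?_
    refine ⟨ℓ w + 1, ?_, ?_⟩
    · simp [s, hw]
    · have := hℓ w
      simp only [Set.mem_Ioi]; linarith
  have hlaw := fun p => hX.measure_path_and_localTimes hr hpos hesc (hℓ v₀).le hBm hB p
  have hint : ∫⁻ l in Set.univ.pi s, ∑' p, N.pathDensity v₀ p l ∂(refMeasure v₀ (ℓ v₀)) ≤ 1 := by
    rw [lintegral_tsum fun p => (measurable_pathDensity p).aemeasurable]
    simp_rw [← fun p => (hlaw p).2]
    rw [← measure_iUnion₀ (fun p p' hne => Disjoint.aedisjoint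
      (Set.disjoint_left.2 fun ω h h' => hne (h.1.symm.trans h'.1))) fun p => (hlaw p).1]
    exact prob_le_one
  have hae := ae_lt_top (Measurable.tsum fun p => measurable_pathDensity (N := N) (v₀ := v₀) p)
    (ne_top_of_le_ne_top ENNReal.one_ne_top hint)
  rw [ae_restrict_iff' hBm] at hae
  have hex : ∃ l ∈ Set.univ.pi s, l v₀ = ℓ v₀ ∧ ∑' p, N.pathDensity v₀ p l < ⊤ := by
    by_contra! hcon
    refine hne ?_
    have : ∀ᵐ l ∂(refMeasure v₀ (ℓ v₀)), l ∉ Set.univ.pi s := by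
      filter_upwards [hae, ae_refMeasure v₀ (ℓ v₀)] with l h1 h2 h3
      exact absurd (h1 h3) (not_lt.2 (hcon l h3 h2))
    exact measure_eq_zero_iff_ae_notMem.2 this
  obtain ⟨l, hl, hl0, hlt⟩ := hex
  refine ⟨l, fun w hw => by simpa [s, hw] using hl w trivial, hl0, ?_⟩
  simp only [Network.pathDensity] at hlt
  rw [ENNReal.tsum_mul_right] at hlt
  refine fun htop => hlt.ne ?_
  rw [htop, ENNReal.top_mul]
  exact Finset.prod_ne_zero_iff.2 fun w _ => by simpa using Real.exp_pos _

lemma Network.pathDensity_le {l l' : V → ℝ} (hesc : ∀ w, 0 < N.escape w) (hl : ∀ w, 0 ≤ l w)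
    (h : ∀ w, l w ≤ l' w) (p : List V) : N.pathDensity v₀ p l ≤ N.pathWeight v₀ l' p := by
  rw [Network.pathDensity, ← mul_one (N.pathWeight v₀ l' p)]
  refine mul_le_mul' (N.pathWeight_mono hl h p) (Finset.prod_le_one' fun w _ => ?_)
  rw [← ENNReal.ofReal_one]
  refine ENNReal.ofReal_le_ofReal (Real.exp_le_one_iff.2 ?_)
  have := mul_nonneg (hesc w).le (hl w)
  linarith

/-- The conditional law given the local times, for walks all of whose trajectories are
right-continuous. -/
lemma Network.IsWalk.exists_isConditionalLaw (hX : N.IsWalk v₀ μ X)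
    (hr : ∀ ω s, ∀ᶠ r in 𝓝[>] s, X r ω = X s ω) (hconn : N.Connected) (hpos : ∀ w, 0 < N.total w)
    (hesc : ∀ w, 0 < N.escape w) {ℓ : V → ℝ} (hℓ : ∀ w, 0 < ℓ w) :
    ∃ ν : PMF (List V), IsConditionalLaw μ (fun ω => N.embeddedPath v₀ (ℓ v₀) (fun s => X s ω))
        (fun ω => N.localTimesAt v₀ (ℓ v₀) (fun s => X s ω)) ℓ ν ∧
      ∑' p, N.pathWeight v₀ ℓ p ≠ 0 ∧ ∑' p, N.pathWeight v₀ ℓ p ≠ ⊤ ∧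
      ∀ p, ν p = N.pathWeight v₀ ℓ p / ∑' p, N.pathWeight v₀ ℓ p := by
  obtain ⟨l', hl', hl0, hsum⟩ := hX.exists_tsum_pathWeight_ne_top hr hpos hesc hℓ
  have hle : ∀ w, ℓ w ≤ l' w := by
    intro w
    by_cases h : w = v₀
    · rw [h, hl0]
    · exact (hl' w h).le
  have hexp0 : ∏ w, ENNReal.ofReal (Real.exp (-(N.escape w * ℓ w))) ≠ 0 :=
    Finset.prod_ne_zero_iff.2 fun w _ => by simpa using Real.exp_pos _
  have hexpt : ∏ w, ENNReal.ofReal (Real.exp (-(N.escape w * ℓ w))) ≠ ⊤ :=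
    ENNReal.prod_ne_top fun w _ => ENNReal.ofReal_ne_top
  have hW0 : ∑' p, N.pathWeight v₀ ℓ p ≠ 0 := by
    obtain ⟨p, hp⟩ := N.exists_pathWeight_ne_zero hconn v₀ hℓ
    exact fun h => hp (ENNReal.tsum_eq_zero.1 h p)
  have hWt : ∑' p, N.pathWeight v₀ ℓ p ≠ ⊤ :=
    ne_top_of_le_ne_top hsum (ENNReal.tsum_le_tsum fun p =>
      N.pathWeight_mono (fun w => (hℓ w).le) hle p)
  have hD : ∑' p, N.pathDensity v₀ p ℓ = (∑' p, N.pathWeight v₀ ℓ p) *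
      ∏ w, ENNReal.ofReal (Real.exp (-(N.escape w * ℓ w))) := ENNReal.tsum_mul_right
  have h0 : ∑' p, N.pathDensity v₀ p ℓ ≠ 0 := by
    rw [hD]; exact mul_ne_zero hW0 hexp0
  have htop : ∑' p, N.pathDensity v₀ p ℓ ≠ ⊤ := by
    rw [hD]; exact ENNReal.mul_ne_top hWt hexpt
  -- Continuity is needed only along the hyperplane carrying the reference measure; there the
  -- majorant applies despite equality at `v₀`. The series is treated as an integral against
  -- counting measure.
  have hcont : ∀ A : Set (List V),
      Tendsto (fun l => ∑' p, A.indicator (fun p => N.pathDensity v₀ p l) p)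
        (𝓝[{l : V → ℝ | l v₀ = ℓ v₀}] ℓ)
        (𝓝 (∑' p, A.indicator (fun p => N.pathDensity v₀ p ℓ) p)) := by
    intro A
    let _ : MeasurableSpace (List V) := ⊤
    simp_rw [← lintegral_count]
    refine tendsto_lintegral_filter_of_dominated_convergence (N.pathWeight v₀ l')
      (Eventually.of_forall fun l => measurable_from_top) ?_ ?_ ?_
    · have hnear : ∀ᶠ l in 𝓝[{l : V → ℝ | l v₀ = ℓ v₀}] ℓ, ∀ w, 0 ≤ l w ∧ l w ≤ l' w := by
        rw [eventually_all]
        intro w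
        have h1 : ∀ᶠ l : V → ℝ in 𝓝 ℓ, 0 < l w :=
          (continuous_apply w).continuousAt.eventually (lt_mem_nhds (hℓ w))
        by_cases h : w = v₀
        · subst h
          filter_upwards [self_mem_nhdsWithin, nhdsWithin_le_nhds h1] with l h2 h3
          exact ⟨h3.le, (le_of_eq h2).trans (le_of_eq hl0.symm)⟩
        · have h2 : ∀ᶠ l : V → ℝ in 𝓝 ℓ, l w < l' w :=
            (continuous_apply w).continuousAt.eventually (gt_mem_nhds (hl' w h))
          filter_upwards [nhdsWithin_le_nhds h1, nhdsWithin_le_nhds h2] with l h3 h4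
          exact ⟨h3.le, h4.le⟩
      filter_upwards [hnear] with l hl
      refine Eventually.of_forall fun p => ?_
      refine (Set.indicator_le_self _ _ p).trans ?_
      exact N.pathDensity_le hesc (fun w => (hl w).1) (fun w => (hl w).2) p
    · rw [lintegral_count]; exact hsum
    · refine Eventually.of_forall fun p => ?_
      by_cases hp : p ∈ A
      · simp only [Set.indicator_of_mem hp]
        exact ((N.continuous_pathDensity v₀ p).tendsto ℓ).mono_left nhdsWithin_le_nhds
      · simp only [Set.indicator_of_notMem hp]
        exact tendsto_const_nhds
  have hO : IsOpen {l : V → ℝ | ∀ w, 0 < l w} := by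
    simp only [Set.ofPred_forall]
    exact isOpen_iInter_of_finite fun w => isOpen_lt continuous_const (continuous_apply w)
  refine ⟨_, isConditionalLaw_of_density (lam := refMeasure v₀ (ℓ v₀))
    (ρ := N.pathDensity v₀) hO hℓ measurable_pathDensity
    (fun B hB hBm p => (hX.measure_path_and_localTimes hr hpos hesc (hℓ v₀).le hBm hB p).1)
    (fun B hB hBm p => (hX.measure_path_and_localTimes hr hpos hesc (hℓ v₀).le hBm hB p).2)
    (ae_refMeasure v₀ (ℓ v₀)) (fun U hU => refMeasure_nhds_ne_zero hℓ hU) hcont h0 htop,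
    hW0, hWt, fun p => ?_⟩
  rw [PMF.normalize_apply, hD, ← div_eq_mul_inv, Network.pathDensity]
  exact ENNReal.mul_div_mul_right _ _ hexp0 hexpt

omit [IsProbabilityMeasure μ] in
/-- A modification of the walk all of whose trajectories are right-continuous. -/
lemma Network.IsWalk.exists_modification (hX : N.IsWalk v₀ μ X) :
    ∃ X' : ℝ≥0 → Ω → V, N.IsWalk v₀ μ X' ∧ (∀ ω s, ∀ᶠ r in 𝓝[>] s, X' r ω = X' s ω) ∧
      ∀ᵐ ω ∂μ, ∀ s, X' s ω = X s ω := by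
  classical
  -- The exceptional set need not be measurable, so the trajectory is frozen at `v₀` on its
  -- measurable hull, which is still null.
  set G := {ω | ¬ ∀ s, ∀ᶠ r in 𝓝[>] s, X r ω = X s ω} with hG
  have hG0 : μ (toMeasurable μ G) = 0 := by
    rw [measure_toMeasurable]; exact ae_iff.1 hX.rightCont
  let X' : ℝ≥0 → Ω → V := fun s ω => if ω ∈ toMeasurable μ G then v₀ else X s ω
  have hae : ∀ᵐ ω ∂μ, ∀ s, X' s ω = X s ω := by
    have : ∀ᵐ ω ∂μ, ω ∉ toMeasurable μ G := measure_eq_zero_iff_ae_notMem.1 hG0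
    filter_upwards [this] with ω hω s
    exact if_neg hω
  have hrc : ∀ ω s, ∀ᶠ r in 𝓝[>] s, X' r ω = X' s ω := by
    intro ω s
    by_cases h : ω ∈ toMeasurable μ G
    · simp [X', h]
    · have : ω ∉ G := fun hm => h (subset_toMeasurable μ G hm)
      simp only [hG, Set.mem_ofPred_eq, not_not] at this
      simpa only [X', h, if_false] using this s
  refine ⟨X', ⟨fun s w => ?_, Eventually.of_forall hrc, fun n y r h0 hy => ?_⟩, hrc, hae⟩
  · have : {ω | X' s ω = w} = (toMeasurable μ G ∩ {_ω | v₀ = w}) ∪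
        ((toMeasurable μ G)ᶜ ∩ {ω | X s ω = w}) := by
      ext ω
      by_cases h : ω ∈ toMeasurable μ G <;> simp [X', h]
    rw [this]
    exact ((measurableSet_toMeasurable μ G).inter (MeasurableSet.const _)).union
      ((measurableSet_toMeasurable μ G).compl.inter (hX.measurable s w))
  · rw [← hX.law n y r h0 hy]
    refine measure_congr ?_
    filter_upwards [hae] with ω hω
    refine propext ?_
    have e : (fun s => X' s ω) = fun s => X s ω := funext hω
    change ((∀ i ≤ n, jumpTime (fun s => X' s ω) i ≠ ⊤ ∧
        (fun s => X' s ω) (jumpTime (fun s => X' s ω) i).toNNReal = y i) ∧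
        ∀ i < n, jumpTime (fun s => X' s ω) i + r i < jumpTime (fun s => X' s ω) (i + 1)) ↔ _
    rw [e]
    rfl

lemma isConditionalLaw_of_const {S ι : Type*} [Fintype ι] {Z : Ω → S} {L : Ω → ι → ℝ} {z : S}
    {ℓ : ι → ℝ} (hZ : ∀ ω, Z ω = z) (hL : ∀ ω, L ω = ℓ) :
    IsConditionalLaw μ Z L ℓ (PMF.pure z) := by
  classical
  refine ⟨fun B hB => ?_, fun A => ?_⟩
  · simp [hL, mem_of_mem_nhds hB]
  · refine tendsto_const_nhds.congr' ?_
    refine eventually_inf_principal.2 (Eventually.of_forall fun B hB => ?_)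
    have hℓB : ℓ ∈ B := by
      by_contra h
      have := hB.2
      simp [hL, h] at this
    rw [PMF.toOuterMeasure_pure_apply]
    simp only [hZ, hL, hℓB, and_true]
    by_cases h : z ∈ A <;> simp [h]

/-- With one vertex the escape rate is zero and the exponential description breaks down, but path
and local times are deterministic. -/
lemma embeddedPath_of_subsingleton [Subsingleton V] (hpos : ∀ w, 0 < N.total w) {t : ℝ}
    (ht : 0 ≤ t) (x : ℝ≥0 → V) :
    N.embeddedPath v₀ t x = [v₀] ∧ N.localTimesAt v₀ t x = fun _ => t := by
  have hc := hpos v₀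
  have hloc : ∀ w s, N.localTime x w s = s / N.total v₀ := by
    intro w s
    obtain rfl : w = v₀ := Subsingleton.elim _ _
    simp [Network.localTime, Subsingleton.elim _ w]
    ring
  have hinv : N.invLocalTime v₀ x t = ENNReal.ofReal (N.total v₀ * t) := by
    have hnn : 0 ≤ N.total v₀ * t := mul_nonneg hc.le ht
    simp only [Network.invLocalTime, hloc, lt_div_iff₀ hc]
    apply le_antisymm
    · refine le_of_forall_gt_imp_ge_of_dense fun b hb => ?_
      obtain ⟨b', hb1, hb2⟩ := exists_between hb
      have hbt : b' ≠ ⊤ := hb2.ne_top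
      have hb3 := (ENNReal.ofReal_lt_iff_lt_toReal hnn hbt).1 hb1
      refine (iInf₂_le b'.toNNReal ?_).trans ((ENNReal.coe_toNNReal hbt).le.trans hb2.le)
      rw [mul_comm]
      exact hb3
    · refine le_iInf₂ fun s hs => ?_
      rw [mul_comm] at hs
      rw [← ENNReal.ofReal_coe_nnreal]
      exact ENNReal.ofReal_le_ofReal hs.le
  constructor
  · have hnum : N.numJumps v₀ t x = 0 := by
      have : {k : ℕ | jumpTime x k ≤ N.invLocalTime v₀ x t} = {0} := by
        ext k
        cases k with
        | zero => simp [jumpTime]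
        | succ k =>
          have : jumpTime x (k + 1) = ⊤ := by
            rw [jumpTime, iInf_eq_top]
            intro r
            rw [iInf_eq_top]
            exact fun h => absurd (Subsingleton.elim _ _) h.2
          simp [this, hinv]
      rw [Network.numJumps, this, csSup_singleton]
    rw [Network.embeddedPath, hnum]
    simp [Subsingleton.elim _ v₀]
  · funext w
    rw [Network.localTimesAt, hloc, hinv, ENNReal.toReal_ofReal (mul_nonneg hc.le ht)]
    field_simp

end Main

theorem proposition4p9 {V : Type*} [Fintype V] [DecidableEq V] (N : Network V)
    (hconn : N.Connected) (hpos : ∀ w, 0 < N.total w) (v₀ v : V)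
    {Ω : Type*} [MeasurableSpace Ω] (μ : Measure Ω) [IsProbabilityMeasure μ]
    (X : ℝ≥0 → Ω → V) (hX : N.IsWalk v₀ μ X)
    (ℓ : V → ℝ) (hℓ : ∀ w, 0 < ℓ w)
    (hthin : ∀ u ∈ N.nbrs v, ℓ u * ℓ v * N.c u v ^ 2 ≤ 1 / 16) :
    ∃ ν : PMF (List V),
      IsConditionalLaw μ (fun ω => N.embeddedPath v₀ (ℓ v₀) (fun s => X s ω))
        (fun ω => N.localTimesAt v₀ (ℓ v₀) (fun s => X s ω)) ℓ ν ∧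
      1 / 2 ≤ ν.toOuterMeasure {P | N.visits P v ≤ 1118 * (N.nbrs v).card} := by
  classical
  rcases subsingleton_or_nontrivial V with hV | hV
  · refine ⟨PMF.pure [v₀], isConditionalLaw_of_const
      (fun ω => (embeddedPath_of_subsingleton hpos (hℓ v₀).le _).1) (fun ω => ?_), ?_⟩
    · rw [(embeddedPath_of_subsingleton hpos (hℓ v₀).le _).2]
      exact funext fun w => by rw [Subsingleton.elim w v₀]
    · have : [v₀] ∈ {P | N.visits P v ≤ 1118 * (N.nbrs v).card} := by
        simp [Network.visits, traversals]
      rw [PMF.toOuterMeasure_pure_apply, if_pos this]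
      exact ENNReal.half_le_self
  · obtain ⟨X', hX', hr, hae⟩ := hX.exists_modification
    obtain ⟨ν, hν, hW0, hWt, hνp⟩ :=
      hX'.exists_isConditionalLaw hr hconn hpos (N.escape_pos hconn hpos) hℓ
    refine ⟨ν, hν.congr ?_, ?_⟩
    · filter_upwards [hae] with ω hω
      have e : (fun s => X' s ω) = fun s => X s ω := funext hω
      exact ⟨by rw [e], by rw [e]⟩
    · set W := N.pathWeight v₀ ℓ with hW
      set A := {P | N.visits P v ≤ 1118 * (N.nbrs v).card} with hA
      have hbad : 2 * ∑' p, Aᶜ.indicator W p ≤ ∑' p, W p :=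
        N.tsum_pathWeight_le (fun w => (hℓ w).le) hthin
      have hsplit : ∑' p, A.indicator W p + ∑' p, Aᶜ.indicator W p = ∑' p, W p := by
        rw [← ENNReal.tsum_add]
        exact tsum_congr fun p => Set.indicator_self_add_compl_apply A W p
      have hout : ν.toOuterMeasure A = (∑' p, A.indicator W p) / ∑' p, W p := by
        rw [PMF.toOuterMeasure_apply, ENNReal.div_eq_inv_mul, ← ENNReal.tsum_mul_left]
        refine tsum_congr fun p => ?_
        by_cases hp : p ∈ A
        · simp [hp, hνp, ENNReal.div_eq_inv_mul]
        · simp [hp]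
      have hbt : ∑' p, Aᶜ.indicator W p ≠ ⊤ :=
        ne_top_of_le_ne_top hWt (hsplit ▸ le_add_self)
      -- Twice the bad mass is at most good plus bad; the bad mass is finite, so one copy cancels.
      have hgood : ∑' p, Aᶜ.indicator W p ≤ ∑' p, A.indicator W p := by
        rw [← hsplit, two_mul] at hbad
        exact (ENNReal.add_le_add_iff_right hbt).1 hbad
      rw [hout, ENNReal.le_div_iff_mul_le (Or.inl hW0) (Or.inl hWt), one_div, mul_comm,
        ← div_eq_mul_inv]
      refine ENNReal.div_le_of_le_mul ?_
      rw [mul_two, ← hsplit]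
      exact add_le_add_right hgood _
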